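/- Conventions. Let $(b;q)_k=\prod_{j=0}^{k-1}(1-bq^j)$, $(b_1,\dots,b_r;q)_k=\prod_j (b_j;q)_k$, and let $${}_{r+1}\phi_r\left({q^{-n},a_1,\dots,a_r\atop b_1,\dots,b_r}\Big|\,q;z\right)=\sum_{k=0}^n\frac{(q^{-n},a_1,\dots,a_r;q)_k}{(b_1,\dots,b_r,q;q)_k}z^k .$$ The $q$-Racah polynomials and their data are $$R_n(x;\alpha,\beta,\gamma,\delta)={}_4\phi_3\left({q^{-n},\alpha\beta q^{n+1},q^{-x},\gamma\delta q^{x+1}\atop \alpha q,\beta\delta q,\gamma q}\Big|\,q;q\right),\qquad \lambda(x;a)=q^{-x}+aq^{x+1},$$ $$A_n(\alpha,\beta,\gamma,\delta)=\frac{(1-\alpha q^{n+1})(1-\alpha\beta q^{n+1})(1-\beta\delta q^{n+1})(1-\gamma q^{n+1})}{(1-\alpha\beta q^{2n+1})(1-\alpha\beta q^{2n+2})},$$ $$C_n(\alpha,\beta,\gamma,\delta)=\frac{q(1-q^n)(1-\beta q^n)(\gamma-\alpha\beta q^n)(\delta-\alpha q^n)}{(1-\alpha\beta q^{2n})(1-\alpha\beta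 q^{2n+1})},\qquad B_n=-A_n-C_n+1+\gamma\delta q$$ (with $C_0=0$ and $A_N=0$ when $\gamma=q^{-N-1}$), $$\Omega_{n;\alpha,\beta,\gamma,\delta}=\frac{(\alpha q,\gamma q,\beta\delta q,\alpha\beta q;q)_n}{(q,\alpha\beta q/\gamma,\alpha q/\delta,\beta q;q)_n}\,\frac{1-\alpha\beta q^{2n+1}}{(\gamma\delta q)^n(1-\alpha\beta q)},$$ $$M_{\alpha,\beta,\gamma,\delta}=\frac{(\gamma q/\beta,\delta q;q)_N}{(1/\beta,\gamma\delta q^2;q)_N}\ \text{ if the first parameter is } q^{-N-1},\qquad M_{\alpha,\beta,\gamma,\delta}=\frac{(\alpha q/\delta,\beta q;q)_N}{(\alpha\beta q^2,1/\delta;q)_N}\ \text{ if the third parameter is } q^{-N-1}.$$ The Wilson rational functions are, for $bcdef=1$, $$W_n(x;a,b,c,d,e,f)={}_{10}\phi_9\left({a,q\sqrt a,-q\sqrt a,q^{-n},bq^{n+1},q^{-x},cq^{x+1},ad,ae,af\atop \sqrt a,-\sqrt a,aq^{-n}/b,aq^{n+1},aq^{-x}/c,aq^{x+1},q/d,q/e,q/f}\Big|\,q;q\right).$$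 An irreducible Leonard trio on a finite-dimensional complex vector space is a triple $(V,\widetilde V,Z)$ of endomorphisms such that: (i) in some basis $V$ is diagonal, $\widetilde VZ$ is tridiagonal and $Z$ is irreducible tridiagonal (tridiagonal with no zero entry on the sub- and superdiagonal); (ii) in some basis $\widetilde V$ is diagonal, $ZV$ is tridiagonal and $Z$ is irreducible tridiagonal; (iii) in some basis $Z$ is diagonal and $V,\widetilde V$ are irreducible tridiagonal. Statement. Let $N\ge 0$ be an integer, let $q,\alpha,\beta,\delta,s$ be nonzero complex numbers with $q$ not a root of unity, and let $\gamma=q^{-N-1}$. Assume that the parameters are generic, in the sense that - for $1\le k\le N$: $\alpha q^k\ne1$, $\beta q^k\ne1$, $\beta\delta q^k\ne1$, $\alpha q^k\ne\delta$, $q^k\ne s$, $\alpha\beta sq^k\ne1$; - for $1\le k\le 2N+1$: $\alpha\beta q^k\ne1$, $\gamma\delta q^k\ne1$, $\alpha\gamma q^k\ne\beta\delta$, $\alpha\gamma sq^k\ne1$; - for $0\le k\le N-1$: $\delta q^k\ne\alpha s$, $q^k\ne\beta\delta s$. On $\mathbb C^{N+1}$ with standard basis $z_0,\dots,z_N$ (and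 $z_{-1}=z_{N+1}=0$) define $$Zz_i=\big(q^{-i}+\alpha\beta q^{i+1}+\sigma\big)z_i,\qquad \sigma=-\tfrac1s-qs\alpha\beta,$$ $$Vz_i=C_{i+1}z_{i+1}+B_iz_i+A_{i-1}z_{i-1},\qquad \widetilde Vz_i=\widetilde C_{i+1}\nu_{i+1}z_{i+1}+\widetilde B_iz_i+\widetilde A_{i-1}\nu_i^{-1}z_{i-1},$$ where $A,B,C$ have parameters $(\alpha,\beta,\gamma,\delta)$, $\widetilde A,\widetilde B,\widetilde C$ have parameters $(\alpha,\beta,\gamma,\alpha/(\beta\delta))$, and $$\nu_i=\frac{\beta(s-q^i)(\delta-\alpha q^i)}{(1-\beta\delta q^i)(1-\alpha\beta sq^i)} .$$ For $0\le n,x\le N$ put $$v_n=\sum_{i=0}^NR_i(n;\alpha,\beta,\gamma,\delta)\,z_i,\qquad \widetilde v_x=\sum_{i=0}^N\frac{(\beta\delta s)^i(q/s,q\alpha/\delta;q)_i}{(\beta\delta q,\alpha\beta sq;q)_i}R_i\big(x;\alpha,\beta,\gamma,\tfrac{\alpha}{\beta\delta}\big)\,z_i .$$ Then $(v_n)$ and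 $(\widetilde v_x)$ are bases with $Vv_n=\lambda(n;\gamma\delta)v_n$ and $\widetilde V\widetilde v_x=\lambda(x;\alpha\gamma/(\beta\delta))\widetilde v_x$, and $(V,\widetilde V,Z)$ is an irreducible Leonard trio, conditions (i), (ii), (iii) holding in the bases $(v_n)$, $(\widetilde v_x)$, $(z_i)$ respectively. Let $w_n(x)=\langle\widetilde v_x^\star,v_n\rangle$ be the overlap coefficients, where $(\widetilde v_x^\star)$ is the basis dual to $(\widetilde v_x)$; that is, $v_n=\sum_{x=0}^Nw_n(x)\widetilde v_x$. Then, for all $0\le n,x\le N$, $$w_n(x)=M_{\gamma,\alpha/(\beta\delta),\alpha,\beta}\,\Omega_{x;\gamma,\alpha/(\beta\delta),\alpha,\beta}\sum_{i=0}^N\Omega_{i;\alpha,\beta,\gamma,\alpha s}R_i\big(x;\alpha,\beta,\gamma,\tfrac{\alpha}{\beta\delta}\big)R_i(n;\alpha,\beta,\gamma,\delta)$$ and $$w_n(x)=M_{\alpha,1/(q\alpha s),\gamma,\alpha/(\beta\delta)}\,\Omega_{x;\alpha,\gamma/(\beta\delta),\gamma,1/(sq\gamma)}\,\frac{(\delta/(\alpha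 s),\gamma q/\beta;q)_n(\alpha\beta sq)^n}{(\beta\delta q,\alpha\gamma sq^2;q)_n}\,W_n\big(x;\alpha\gamma sq,\gamma\delta,\tfrac{\alpha\gamma}{\beta\delta},\tfrac1\gamma,\tfrac1\alpha,\tfrac\beta\gamma\big).$$ Equivalently, $$W_n\big(x;\alpha\gamma sq,\gamma\delta,\tfrac{\alpha\gamma}{\beta\delta},\tfrac1\gamma,\tfrac1\alpha,\tfrac\beta\gamma\big)=\frac{(\alpha q/\delta,\alpha\gamma sq^2;q)_x}{(1/(\beta\delta s),\gamma q/\beta;q)_x(\alpha\beta sq)^x}\,\frac{(\beta\delta q,\alpha\gamma sq^2;q)_n}{(\delta/(\alpha s),\gamma q/\beta;q)_n(\alpha\beta sq)^n}\,M_{\gamma,\alpha s,\alpha,\beta}\sum_{i=0}^N\Omega_{i;\alpha,\beta,\gamma,\alpha s}R_i\big(x;\alpha,\beta,\gamma,\tfrac{\alpha}{\beta\delta}\big)R_i(n;\alpha,\beta,\gamma,\delta).$$ -/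

import Mathlib

open Module

noncomputable section

/-! ### Basic hypergeometric series -/

/-- The `q`-Pochhammer symbol `(b;q)_k = (1-b)(1-qb)⋯(1-q^{k-1}b)`. -/
def qPoch (q b : ℂ) (k : ℕ) : ℂ := ∏ j ∈ Finset.range k, (1 - q ^ j * b)

/-- `(b₁,…,b_r;q)_k = (b₁;q)_k ⋯ (b_r;q)_k`. -/
def qPochs (q : ℂ) (bs : List ℂ) (k : ℕ) : ℂ := (bs.map fun b => qPoch q b k).prod

/-- The terminating series `_{r+1}φ_r(q^{-n}, a₁,…,a_r; b₁,…,b_r | q; z)`;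
the numerator parameter `q^{-n}` is included by the definition. -/
def qHyp (q : ℂ) (n : ℕ) (as bs : List ℂ) (z : ℂ) : ℂ :=
  ∑ k ∈ Finset.range (n + 1),
    qPochs q (q ^ (-(n : ℤ)) :: as) k / qPochs q (bs ++ [q]) k * z ^ k

/-! ### The `q`-Racah polynomials and their data -/

/-- The `q`-Racah polynomial `R_n(x; α, β, γ, δ)` as a `₄φ₃`. -/
def qRacah (q : ℂ) (n x : ℕ) (α β γ δ : ℂ) : ℂ :=
  qHyp q n [α * β * q ^ (n + 1), q ^ (-(x : ℤ)), γ * δ * q ^ (x + 1)]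
    [α * q, β * δ * q, γ * q] q

/-- `λ(x; a) = q^{-x} + a q^{x+1}`. -/
def qRacahEig (q : ℂ) (x : ℕ) (a : ℂ) : ℂ := q ^ (-(x : ℤ)) + a * q ^ (x + 1)

/-- The recurrence coefficient `A_n(α, β, γ, δ)`. -/
def qRacahA (q : ℂ) (n : ℕ) (α β γ δ : ℂ) : ℂ :=
  (1 - α * q ^ (n + 1)) * (1 - α * β * q ^ (n + 1)) * (1 - β * δ * q ^ (n + 1))
      * (1 - γ * q ^ (n + 1))
    / ((1 - α * β * q ^ (2 * n + 1)) * (1 - α * β * q ^ (2 * n + 2)))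

/-- The recurrence coefficient `C_n(α, β, γ, δ)`. -/
def qRacahC (q : ℂ) (n : ℕ) (α β γ δ : ℂ) : ℂ :=
  q * (1 - q ^ n) * (1 - β * q ^ n) * (γ - α * β * q ^ n) * (δ - α * q ^ n)
    / ((1 - α * β * q ^ (2 * n)) * (1 - α * β * q ^ (2 * n + 1)))

/-- The recurrence coefficient `B_n(α, β, γ, δ)`. -/
def qRacahB (q : ℂ) (n : ℕ) (α β γ δ : ℂ) : ℂ :=
  -qRacahA q n α β γ δ - qRacahC q n α β γ δ + 1 + γ * δ * q

/-- The weight `Ω_{n; α, β, γ, δ}`. -/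
def qRacahWeight (q : ℂ) (n : ℕ) (α β γ δ : ℂ) : ℂ :=
  qPochs q [α * q, γ * q, β * δ * q, α * β * q] n
      / qPochs q [q, α * β * q / γ, α * q / δ, β * q] n
    * ((1 - α * β * q ^ (2 * n + 1)) / ((γ * δ * q) ^ n * (1 - α * β * q)))

/-- The normalisation `M_{α, β, γ, δ}` in the case where the first parameter is `q^{-N-1}`. -/
def qRacahMassFst (q : ℂ) (N : ℕ) (_α β γ δ : ℂ) : ℂ :=
  qPochs q [γ * q / β, δ * q] N / qPochs q [1 / β, γ * δ * q ^ 2] N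

/-- The normalisation `M_{α, β, γ, δ}` in the case where the third parameter is `q^{-N-1}`. -/
def qRacahMassThd (q : ℂ) (N : ℕ) (α β _γ δ : ℂ) : ℂ :=
  qPochs q [α * q / δ, β * q] N / qPochs q [α * β * q ^ 2, 1 / δ] N

/-! ### The Wilson rational functions -/

/-- The Wilson rational function `W_n(x; a, b, c, d, e, f)` as a very-well-poised `₁₀φ₉`
(used for `b c d e f = 1`). -/
def wilsonRat (q : ℂ) (n x : ℕ) (a b c d e f : ℂ) : ℂ :=
  qHyp q n
    [a, q * a.sqrt, -(q * a.sqrt), b * q ^ (n + 1), q ^ (-(x : ℤ)),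
      c * q ^ (x + 1), a * d, a * e, a * f]
    [a.sqrt, -(a.sqrt), a * q ^ (-(n : ℤ)) / b, a * q ^ (n + 1),
      a * q ^ (-(x : ℤ)) / c, a * q ^ (x + 1), q / d, q / e, q / f] q

/-! ### Irreducible Leonard trios -/

/-- Each nonzero entry lies on the diagonal, the subdiagonal or the superdiagonal. -/
def IsTridiagonal {d : ℕ} (M : Matrix (Fin d) (Fin d) ℂ) : Prop :=
  ∀ i j : Fin d, (i : ℕ) + 1 < j ∨ (j : ℕ) + 1 < i → M i j = 0

/-- Tridiagonal, with all entries on the subdiagonal and on the superdiagonal nonzero. -/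
def IsIrredTridiagonal {d : ℕ} (M : Matrix (Fin d) (Fin d) ℂ) : Prop :=
  IsTridiagonal M ∧ ∀ i j : Fin d, (i : ℕ) + 1 = j ∨ (j : ℕ) + 1 = i → M i j ≠ 0

/-- `(V, Ṽ, Z)` is an irreducible Leonard trio, the three conditions of the definition being
witnessed by the ordered bases `v`, `vt` and `z` respectively. -/
structure IsIrredLeonardTrio {d : ℕ} {E : Type*} [AddCommGroup E] [Module ℂ E]
    (V Vt Z : Module.End ℂ E) (v vt z : Basis (Fin d) ℂ E) : Prop where
  diag_V : (LinearMap.toMatrix v v V).IsDiag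
  tridiag_VtZ : IsTridiagonal (LinearMap.toMatrix v v (Vt * Z))
  irred_Z : IsIrredTridiagonal (LinearMap.toMatrix v v Z)
  diag_Vt : (LinearMap.toMatrix vt vt Vt).IsDiag
  tridiag_ZV : IsTridiagonal (LinearMap.toMatrix vt vt (Z * V))
  irred_Z' : IsIrredTridiagonal (LinearMap.toMatrix vt vt Z)
  diag_Z : (LinearMap.toMatrix z z Z).IsDiag
  irred_V : IsIrredTridiagonal (LinearMap.toMatrix z z V)
  irred_Vt : IsIrredTridiagonal (LinearMap.toMatrix z z Vt)

/-! ### The trio of `q`-Racah type, acting on `ℂ^{N+1}` with standard basis `z_0, …, z_N` -/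

/-- The operator
`z_i ↦ C_{i+1} ν_{i+1} z_{i+1} + B_i z_i + A_{i-1} ν_i⁻¹ z_{i-1}`
with the `q`-Racah coefficients `A, B, C` of parameters `α, β, γ, δ`. -/
def qRacahOp (q : ℂ) (N : ℕ) (α β γ δ : ℂ) (ν : ℕ → ℂ) :
    Module.End ℂ (Fin (N + 1) → ℂ) :=
  Matrix.toLin' (Matrix.of fun j i : Fin (N + 1) =>
    if (j : ℕ) = i + 1 then qRacahC q j α β γ δ * ν j
    else if j = i then qRacahB q i α β γ δ
    else if (j : ℕ) + 1 = i then qRacahA q j α β γ δ * (1 / ν i)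
    else 0)

/-- The normalisation `ν_i`. -/
def trioNu (q α β δ s : ℂ) (i : ℕ) : ℂ :=
  β * (s - q ^ i) * (δ - α * q ^ i) / ((1 - β * δ * q ^ i) * (1 - α * β * s * q ^ i))

/-- The operator `V`. -/
def trioV (q : ℂ) (N : ℕ) (α β γ δ : ℂ) : Module.End ℂ (Fin (N + 1) → ℂ) :=
  qRacahOp q N α β γ δ fun _ => 1

/-- The operator `Ṽ`, of `q`-Racah parameters `α, β, γ, α/(βδ)`. -/
def trioVt (q : ℂ) (N : ℕ) (α β γ δ s : ℂ) : Module.End ℂ (Fin (N + 1) → ℂ) :=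
  qRacahOp q N α β γ (α / (β * δ)) (trioNu q α β δ s)

/-- The operator `Z`, with `Z z_i = (q^{-i} + αβ q^{i+1} + σ) z_i`, `σ = -1/s - q s α β`. -/
def trioZ (q : ℂ) (N : ℕ) (α β s : ℂ) : Module.End ℂ (Fin (N + 1) → ℂ) :=
  Matrix.toLin' (Matrix.diagonal fun i : Fin (N + 1) =>
    qRacahEig q i (α * β) + (-1 / s - q * s * α * β))

/-- The eigenvector `v_n` of `V`. -/
def trioVecV (q : ℂ) (N : ℕ) (α β γ δ : ℂ) (n : ℕ) : Fin (N + 1) → ℂ :=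
  fun i => qRacah q i n α β γ δ

/-- The eigenvector `ṽ_x` of `Ṽ`. -/
def trioVecVt (q : ℂ) (N : ℕ) (α β γ δ s : ℂ) (x : ℕ) : Fin (N + 1) → ℂ :=
  fun i => (β * δ * s) ^ (i : ℕ) * qPochs q [q / s, q * α / δ] i
      / qPochs q [β * δ * q, α * β * s * q] i
    * qRacah q i x α β γ (α / (β * δ))

end

/-!
The vectors `v_n` and `ṽ_x` have as coordinates `q`-Racah polynomials in the degree `i`, with
fourth parameters `δ` and `δ' = α/(βδ)`, the second ones up to a diagonal rescaling by
`trioScale`. Both are therefore eigenvectors by the three-term recurrence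
(`RacahGeneric.recurrence`), which follows by expanding both variables in the products
`φ_k(n) = (q^{-n}, a q^{n+1}; q)_k` and telescoping. The eigenvalues are distinct, so that the
eigenvectors form bases. In these bases `Z` is tridiagonal because of the dual difference equation
(`RacahGeneric.difference`, the recurrence after exchanging degree and variable).

For the products, there are scalars with `ṼZ = aVZ + bZV + cV + e` and
`ZV = a'ṼZ + b'ZṼ + c'Ṽ + e'` (`TrioGeneric.Vt_mul_Z`, `TrioGeneric.Z_mul_V`), and the right-hand
sides are tridiagonal wherever `V`, respectively `Ṽ`, is diagonal and `Z` is tridiagonal. Off the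
diagonal these relations are linear conditions on `a`, `b`, `c`; on the diagonal they rest on
`RacahGeneric.qRacahB_relation`: the combination `(1 + q)βδ B̃_i + (q^{-i} + αβ q^{i+1}) B_i` does
not depend on `i`.

Orthogonality holds because the recurrence operator is symmetric for the weight `Ω`. The norms
(`RacahGeneric.norm`) follow by induction from the total mass, which is a terminating
very-well-poised `₆φ₅` series; that sum (`sixPhiFive_sum`) is proved by a contiguous relation that
telescopes. After the rescaling, the weight for `δ'` becomes `Ω_{i;α,β,γ,αs}`, and so the
coordinates with respect to `(ṽ_x)` are given by the first formula for `w_n(x)`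
(`TrioGeneric.coord_eq`).

For the second formula, both factors `R_i(x)` and `R_i(n)` of that sum are expanded in the family
with fourth parameter `αs`, which is orthogonal for the weight of the sum. The expansion
coefficients are single quotients of Pochhammer symbols, again by the `₆φ₅` sum
(`qRacah_eq_sum_connCoeff`). Orthogonality leaves one sum over `k` of products of two such
coefficients divided by a dual weight (`mass_mul_sum_weight_qRacah`), and these are the terms of the
Wilson rational function (`TrioGeneric.sum_connCoeff_eq_wilsonRat`).
-/

/-! ### `q`-Pochhammer symbols -/

section QPoch

variable {q : ℂ}

@[simp] theorem qPoch_zero (b : ℂ) : qPoch q b 0 = 1 := by simp [qPoch]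

theorem qPoch_succ (b : ℂ) (k : ℕ) : qPoch q b (k + 1) = qPoch q b k * (1 - q ^ k * b) := by
  simp [qPoch, Finset.prod_range_succ]

theorem qPoch_add (b : ℂ) (m k : ℕ) :
    qPoch q b (m + k) = qPoch q b m * qPoch q (q ^ m * b) k := by
  simp only [qPoch, Finset.prod_range_add]
  congr 1
  exact Finset.prod_congr rfl fun j _ => by ring

theorem qPoch_succ' (b : ℂ) (k : ℕ) : qPoch q b (k + 1) = (1 - b) * qPoch q (q * b) k := by
  rw [add_comm, qPoch_add, qPoch_succ]; simp

theorem qPoch_ne_zero {b : ℂ} {k : ℕ} (h : ∀ j < k, q ^ j * b ≠ 1) : qPoch q b k ≠ 0 :=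
  Finset.prod_ne_zero_iff.2 fun j hj => sub_ne_zero.2 (h j (Finset.mem_range.1 hj)).symm

theorem qPoch_eq_zero {b : ℂ} {j k : ℕ} (hj : j < k) (h : q ^ j * b = 1) : qPoch q b k = 0 :=
  Finset.prod_eq_zero (Finset.mem_range.2 hj) (by rw [h, sub_self])

theorem qPoch_neg_eq_zero (hq0 : q ≠ 0) {n k : ℕ} (h : n < k) :
    qPoch q (q ^ (-(n : ℤ))) k = 0 :=
  qPoch_eq_zero h (by rw [zpow_neg, zpow_natCast]; exact mul_inv_cancel₀ (pow_ne_zero _ hq0))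

theorem qPoch_self_ne_zero (hq : ∀ k : ℕ, 0 < k → q ^ k ≠ 1) (k : ℕ) : qPoch q q k ≠ 0 :=
  qPoch_ne_zero fun j _ => by rw [← pow_succ]; exact hq _ j.succ_pos

/-- Reversal of the order of the factors. -/
theorem qPoch_reverse (hq0 : q ≠ 0) {y : ℂ} (hy : y ≠ 0) (n : ℕ) :
    qPoch q (q ^ (-(n : ℤ)) / y) n = (∏ j ∈ Finset.range n, -(q ^ (j + 1) * y)⁻¹)
      * qPoch q (y * q) n := by
  rw [qPoch, qPoch, ← Finset.prod_mul_distrib, ← Finset.prod_range_reflect]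
  refine Finset.prod_congr rfl fun j hj => ?_
  have hj := Finset.mem_range.1 hj
  obtain ⟨m, rfl⟩ := Nat.exists_eq_add_of_lt hj
  rw [show j + m + 1 - 1 - j = m by omega, zpow_neg, zpow_natCast]
  field_simp
  ring

end QPoch

/-! ### The terminating very-well-poised `₆φ₅` sum -/

section SixPhiFive

variable {q : ℂ}

/-- The summand of the terminating very-well-poised `₆φ₅` series. -/
noncomputable def sixPhiFiveTerm (q a b c : ℂ) (n j : ℕ) : ℂ :=
  qPochs q [a, b, c, q ^ (-(n : ℤ))] j * (1 - a * q ^ (2 * j))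
    / (qPochs q [q, a * q / b, a * q / c, a * q ^ (n + 1)] j * (1 - a))
    * (a * q ^ (n + 1) / (b * c)) ^ j

/-- The contiguous relation between the `₆φ₅` series of lengths `n` and `n + 1` telescopes. For
`m = n + 1` the right-hand side vanishes through `(q^{-n}; q)_{n+1} = 0`, which gives the sum by
induction on `n`. -/
theorem sixPhiFive_partial_sum (hq0 : q ≠ 0) (hq : ∀ k : ℕ, 0 < k → q ^ k ≠ 1) {a b c : ℂ}
    (hb : b ≠ 0) (hc : c ≠ 0) (n : ℕ) (ha : ∀ k ≤ 2 * n + 2, a * q ^ k ≠ 1)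
    (hab : ∀ k ∈ Finset.Icc 1 (n + 1), a * q ^ k ≠ b)
    (hac : ∀ k ∈ Finset.Icc 1 (n + 1), a * q ^ k ≠ c) (m : ℕ) (hm : m ≤ n + 1) :
    ∑ j ∈ Finset.range (m + 1),
      ((1 - a * q ^ (n + 1) / b) * (1 - a * q ^ (n + 1) / c) * sixPhiFiveTerm q a b c (n + 1) j
        - (1 - a * q ^ (n + 1)) * (1 - a * q ^ (n + 1) / (b * c)) * sixPhiFiveTerm q a b c n j)
      = (a * q ^ (n + 1) / (b * c)) ^ (m + 1)
        * (qPoch q (a * q) m * qPoch q b (m + 1) * qPoch q c (m + 1)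
          * qPoch q (q ^ (-(n : ℤ))) m)
        / (qPoch q q m * qPoch q (a * q / b) m * qPoch q (a * q / c) m
          * qPoch q (a * q ^ (n + 2)) m) := by
  induction m with
  | zero =>
    have : 1 - a ≠ 0 := sub_ne_zero.2 (by simpa using (ha 0 (by omega)).symm)
    simp [sixPhiFiveTerm, qPochs, qPoch_succ]
    field_simp
    ring
  | succ m ih =>
    rw [Finset.sum_range_succ, ih (by omega)]
    have h1a : 1 - a ≠ 0 := sub_ne_zero.2 (by simpa using (ha 0 (by omega)).symm)
    have e1 : qPoch q a (m + 1) = (1 - a) * qPoch q (a * q) m := by rw [qPoch_succ', mul_comm q]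
    have e2 : qPoch q (q ^ (-((n + 1 : ℕ) : ℤ))) (m + 1)
        = (1 - (q ^ (n + 1))⁻¹) * qPoch q (q ^ (-(n : ℤ))) m := by
      have hinv : q * (q ^ (n + 1))⁻¹ = (q ^ n)⁻¹ := by field_simp; ring
      rw [qPoch_succ', zpow_neg, zpow_natCast, zpow_neg, zpow_natCast, hinv]
    have e3 : qPoch q (a * q ^ (n + 1)) (m + 1)
        = (1 - a * q ^ (n + 1)) * qPoch q (a * q ^ (n + 2)) m := by
      rw [qPoch_succ']; congr 2; ring
    have e4 : q ^ (-(n : ℤ)) = (q ^ n)⁻¹ := by rw [zpow_neg, zpow_natCast]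
    have n5 : 1 - q ^ m * q ≠ 0 := sub_ne_zero.2 (by
      rw [← pow_succ]; exact (hq _ m.succ_pos).symm)
    have n6 : b - q ^ m * (a * q) ≠ 0 := sub_ne_zero.2 fun h => by
      apply hab (m + 1) (by simp; omega)
      rw [h]; ring
    have n7 : c - q ^ m * (a * q) ≠ 0 := sub_ne_zero.2 fun h => by
      apply hac (m + 1) (by simp; omega)
      rw [h]; ring
    have n6' : 1 - q ^ m * (a * q / b) ≠ 0 := by
      rw [show 1 - q ^ m * (a * q / b) = (b - q ^ m * (a * q)) / b by field_simp]
      exact div_ne_zero n6 hb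
    have n7' : 1 - q ^ m * (a * q / c) ≠ 0 := by
      rw [show 1 - q ^ m * (a * q / c) = (c - q ^ m * (a * q)) / c by field_simp]
      exact div_ne_zero n7 hc
    have n8 : 1 - q ^ m * (a * q ^ (n + 2)) ≠ 0 := sub_ne_zero.2 fun h => by
      apply ha (m + n + 2) (by omega)
      rw [h]; ring
    have n9 : 1 - a * q ^ (n + 1) ≠ 0 := sub_ne_zero.2 (ha (n + 1) (by omega)).symm
    simp only [sixPhiFiveTerm, qPochs, List.map_cons, List.map_nil, List.prod_cons, List.prod_nil,
      mul_one, e1, e2, e3]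
    rw [qPoch_succ q m, qPoch_succ (a * q / b) m, qPoch_succ (a * q / c) m,
      qPoch_succ (q ^ (-(n : ℤ))) m, qPoch_succ (a * q) m, qPoch_succ b (m + 1),
      qPoch_succ c (m + 1), show n + 1 + 1 = n + 2 by ring, qPoch_succ (a * q ^ (n + 2)) m, e4]
    have z1 : (a * q ^ (n + 2) / (b * c)) ^ (m + 1)
        = (a * q ^ (n + 1) / (b * c)) ^ (m + 1) * (q ^ m * q) := by
      rw [← pow_succ, ← mul_pow]; congr 1; ring
    rw [z1, pow_succ _ (m + 1)]
    -- with the symbols and the nonzero factors as atoms, a rational identity remains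
    generalize (a * q ^ (n + 1) / (b * c)) ^ (m + 1) = z
    generalize qPoch q q m = w1 at *
    generalize qPoch q (a * q / b) m = w2 at *
    generalize qPoch q (a * q / c) m = w3 at *
    generalize qPoch q (a * q ^ (n + 2)) m = w4 at *
    generalize qPoch q (a * q) m = w5 at *
    generalize qPoch q b (m + 1) = w6 at *
    generalize qPoch q c (m + 1) = w7 at *
    generalize qPoch q ((q ^ n)⁻¹) m = w8 at *
    clear ih z1 e1 e2 e3 e4 ha hab hac
    rw [show 2 * (m + 1) = m + m + 2 by ring]
    generalize h1 : 1 - a = d1 at *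
    generalize h5 : 1 - q ^ m * q = d5 at *
    generalize h6 : 1 - q ^ m * (a * q / b) = d6 at *
    generalize h7 : 1 - q ^ m * (a * q / c) = d7 at *
    generalize h8 : 1 - q ^ m * (a * q ^ (n + 2)) = d8 at *
    generalize h9 : 1 - a * q ^ (n + 1) = d9 at *
    field_simp
    subst h5 h6 h7 h8 h9
    field_simp
    ring

/-- The terminating very-well-poised `₆φ₅` summation. -/
theorem sixPhiFive_sum (hq0 : q ≠ 0) (hq : ∀ k : ℕ, 0 < k → q ^ k ≠ 1) {a b c : ℂ}
    (hb : b ≠ 0) (hc : c ≠ 0) (n : ℕ) (ha : ∀ k ≤ 2 * n, a * q ^ k ≠ 1)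
    (hab : ∀ k ∈ Finset.Icc 1 n, a * q ^ k ≠ b)
    (hac : ∀ k ∈ Finset.Icc 1 n, a * q ^ k ≠ c) :
    ∑ j ∈ Finset.range (n + 1), sixPhiFiveTerm q a b c n j
      = qPochs q [a * q, a * q / (b * c)] n / qPochs q [a * q / b, a * q / c] n := by
  induction n with
  | zero =>
    have : 1 - a ≠ 0 := sub_ne_zero.2 (by simpa using (ha 0 (by omega)).symm)
    simp [sixPhiFiveTerm, qPochs, this]
  | succ n ih =>
    have ih := ih (fun k hk => ha k (by omega))
      (fun k hk => hab k (by simp at hk ⊢; omega)) (fun k hk => hac k (by simp at hk ⊢; omega))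
    have h := sixPhiFive_partial_sum hq0 hq hb hc n (fun k hk => ha k (by omega)) hab hac
      (n + 1) le_rfl
    have hz : sixPhiFiveTerm q a b c n (n + 1) = 0 := by
      have h0 := qPoch_neg_eq_zero hq0 n.lt_succ_self
      simp only [sixPhiFiveTerm, qPochs, List.map_cons, List.map_nil, List.prod_cons, h0, mul_zero,
        zero_mul, zero_div]
    rw [qPoch_neg_eq_zero hq0 n.lt_succ_self, mul_zero, mul_zero, zero_div,
      Finset.sum_sub_distrib, ← Finset.mul_sum, ← Finset.mul_sum,
      Finset.sum_range_succ (sixPhiFiveTerm q a b c n), hz, add_zero, ih, sub_eq_zero] at h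
    have n1 : 1 - a * q ^ (n + 1) / b ≠ 0 := sub_ne_zero.2 fun h => by
      apply hab (n + 1) (by simp)
      field_simp at h; exact h.symm
    have n2 : 1 - a * q ^ (n + 1) / c ≠ 0 := sub_ne_zero.2 fun h => by
      apply hac (n + 1) (by simp)
      field_simp at h; exact h.symm
    rw [← mul_right_inj' (mul_ne_zero n1 n2), h]
    have n1' : 1 - q ^ n * (a * q / b) ≠ 0 := by convert n1 using 2; ring
    have n2' : 1 - q ^ n * (a * q / c) ≠ 0 := by convert n2 using 2; ring
    simp only [qPochs, List.map_cons, List.map_nil, List.prod_cons, List.prod_nil, mul_one,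
      qPoch_succ]
    rw [show 1 - a * q ^ (n + 1) / b = 1 - q ^ n * (a * q / b) by ring,
      show 1 - a * q ^ (n + 1) / c = 1 - q ^ n * (a * q / c) by ring,
      show 1 - a * q ^ (n + 1) / (b * c) = 1 - q ^ n * (a * q / (b * c)) by ring,
      show 1 - a * q ^ (n + 1) = 1 - q ^ n * (a * q) by ring]
    generalize 1 - q ^ n * (a * q / b) = y1 at *
    generalize 1 - q ^ n * (a * q / c) = y2 at *
    field_simp

end SixPhiFive

/-! ### Expansion and duality of the `q`-Racah polynomials -/

section RacahBasis

variable {q : ℂ}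

/-- `φ_k(n) = (q^{-n}, a q^{n+1}; q)_k`, a polynomial of degree `k` in `q^{-n} + a q^{n+1}`. -/
noncomputable def racahBasis (q a : ℂ) (n k : ℕ) : ℂ :=
  qPoch q (q ^ (-(n : ℤ))) k * qPoch q (a * q ^ (n + 1)) k

theorem racahBasis_zero_right (a : ℂ) (n : ℕ) : racahBasis q a n 0 = 1 := by simp [racahBasis]

theorem racahBasis_eq_zero (hq0 : q ≠ 0) (a : ℂ) {n k : ℕ} (h : n < k) :
    racahBasis q a n k = 0 := by simp only [racahBasis, qPoch_neg_eq_zero hq0 h, zero_mul]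

theorem racahBasis_succ (hq0 : q ≠ 0) (a : ℂ) (n k : ℕ) :
    racahBasis q a n (k + 1)
      = racahBasis q a n k * (1 + a * q ^ (2 * k + 1) - q ^ k * qRacahEig q n a) := by
  rw [racahBasis, racahBasis, qPoch_succ, qPoch_succ, qRacahEig, zpow_neg, zpow_natCast]
  field_simp
  ring

/-- The defining series, with the range of summation extended to a common bound `N`, and with its
dependence on the degree and on the variable separated. -/
theorem qRacah_eq_sum (hq0 : q ≠ 0) {N n : ℕ} (hn : n ≤ N) (x : ℕ) (α β γ δ : ℂ) :
    qRacah q n x α β γ δ = ∑ k ∈ Finset.range (N + 1),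
      q ^ k / qPochs q [α * q, β * δ * q, γ * q, q] k
        * racahBasis q (α * β) n k * racahBasis q (γ * δ) x k := by
  rw [qRacah, qHyp]
  rw [← Finset.sum_subset (Finset.range_subset_range.2 (Nat.succ_le_succ hn))]
  · refine Finset.sum_congr rfl fun k _ => ?_
    simp only [qPochs, racahBasis, List.map_cons, List.map_nil, List.prod_cons, List.prod_nil,
      List.cons_append, List.nil_append]
    ring
  · intro k _ hk
    rw [racahBasis_eq_zero hq0 _ (by simpa using hk)]
    ring

/-- The `q`-Racah polynomials are self-dual. -/
theorem qRacah_swap (hq0 : q ≠ 0) (n x : ℕ) (α β γ δ : ℂ) :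
    qRacah q n x α β γ δ = qRacah q x n γ δ α β := by
  rw [qRacah_eq_sum hq0 (le_max_left n x), qRacah_eq_sum hq0 (le_max_right n x)]
  refine Finset.sum_congr rfl fun k _ => ?_
  simp only [qPochs, List.map_cons, List.map_nil, List.prod_cons, List.prod_nil, mul_comm δ β]
  ring

theorem qRacah_zero_left (x : ℕ) (α β γ δ : ℂ) : qRacah q 0 x α β γ δ = 1 := by
  simp [qRacah, qHyp, qPochs]

theorem qRacah_zero_right (hq0 : q ≠ 0) (n : ℕ) (α β γ δ : ℂ) : qRacah q n 0 α β γ δ = 1 := by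
  rw [qRacah_swap hq0, qRacah_zero_left]

/-- Nondegeneracy of the parameters of the `q`-Racah polynomials of degree at most `N`, in a form
that is symmetric under the duality `(α, β) ↔ (γ, δ)`. -/
structure RacahGeneric (q : ℂ) (N : ℕ) (α β γ δ : ℂ) : Prop where
  q_ne : q ≠ 0
  q_pow : ∀ k : ℕ, 0 < k → q ^ k ≠ 1
  α_ne : α ≠ 0
  β_ne : β ≠ 0
  γ_ne : γ ≠ 0
  δ_ne : δ ≠ 0
  α_pow : ∀ k ∈ Finset.Icc 1 N, α * q ^ k ≠ 1
  β_pow : ∀ k ∈ Finset.Icc 1 N, β * q ^ k ≠ 1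
  γ_pow : ∀ k ∈ Finset.Icc 1 N, γ * q ^ k ≠ 1
  δ_pow : ∀ k ∈ Finset.Icc 1 N, δ * q ^ k ≠ 1
  βδ_pow : ∀ k ∈ Finset.Icc 1 N, β * δ * q ^ k ≠ 1
  αδ_pow : ∀ k ∈ Finset.Icc 1 N, α * q ^ k ≠ δ
  γβ_pow : ∀ k ∈ Finset.Icc 1 N, γ * q ^ k ≠ β
  αβγ_pow : ∀ k ∈ Finset.Icc 1 N, α * β * q ^ k ≠ γ
  γδα_pow : ∀ k ∈ Finset.Icc 1 N, γ * δ * q ^ k ≠ α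
  αβ_pow : ∀ k ∈ Finset.Icc 1 (2 * N + 1), α * β * q ^ k ≠ 1
  γδ_pow : ∀ k ∈ Finset.Icc 1 (2 * N + 1), γ * δ * q ^ k ≠ 1
  cut : α * q ^ (N + 1) = 1 ∨ γ * q ^ (N + 1) = 1

theorem RacahGeneric.symm {N : ℕ} {α β γ δ : ℂ} (h : RacahGeneric q N α β γ δ) :
    RacahGeneric q N γ δ α β where
  q_ne := h.q_ne
  q_pow := h.q_pow
  α_ne := h.γ_ne
  β_ne := h.δ_ne
  γ_ne := h.α_ne
  δ_ne := h.β_ne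
  α_pow := h.γ_pow
  β_pow := h.δ_pow
  γ_pow := h.α_pow
  δ_pow := h.β_pow
  βδ_pow k hk := by rw [mul_comm δ]; exact h.βδ_pow k hk
  αδ_pow := h.γβ_pow
  γβ_pow := h.αδ_pow
  αβγ_pow := h.γδα_pow
  γδα_pow := h.αβγ_pow
  αβ_pow := h.γδ_pow
  γδ_pow := h.αβ_pow
  cut := h.cut.symm

theorem qRacahC_zero (α β γ δ : ℂ) : qRacahC q 0 α β γ δ = 0 := by simp [qRacahC]

theorem RacahGeneric.qRacahA_self {N : ℕ} {α β γ δ : ℂ} (h : RacahGeneric q N α β γ δ) :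
    qRacahA q N α β γ δ = 0 := by
  rcases h.cut with h | h <;> simp [qRacahA, h]

/-- After cancellation the denominator factor `1 - αβ q^{2n+2}` of `A_n` disappears, so that no
assumption on it is needed for `n = N`. -/
theorem RacahGeneric.qRacahA_mul_sub {N : ℕ} {α β γ δ : ℂ} (h : RacahGeneric q N α β γ δ)
    {n : ℕ} (hn : n ≤ N) (k : ℕ) :
    qRacahA q n α β γ δ * (racahBasis q (α * β) (n + 1) (k + 1) - racahBasis q (α * β) n (k + 1))
      = racahBasis q (α * β) n k * ((1 - α * q ^ (n + 1)) * (1 - β * δ * q ^ (n + 1))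
          * (1 - γ * q ^ (n + 1)) * (q ^ (k + 1) - 1) * (1 - α * β * q ^ (n + k + 1))
          / (q ^ (n + 1) * (1 - α * β * q ^ (2 * n + 1)))) := by
  rcases hn.eq_or_lt with rfl | hn
  · rw [h.qRacahA_self]
    rcases h.cut with h | h <;> simp [h]
  have hq0 := h.q_ne
  have w : 1 - α * β * q ^ (2 * n + 2) ≠ 0 :=
    sub_ne_zero.2 (h.αβ_pow _ (by simp; omega)).symm
  have u : 1 - α * β * q ^ (n + 1) ≠ 0 :=
    sub_ne_zero.2 (h.αβ_pow _ (by simp; omega)).symm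
  have e1 : qPoch q (q ^ (-((n + 1 : ℕ) : ℤ))) (k + 1)
      = (1 - (q ^ (n + 1))⁻¹) * qPoch q (q ^ (-(n : ℤ))) k := by
    have hinv : q * (q ^ (n + 1))⁻¹ = (q ^ n)⁻¹ := by field_simp; ring
    rw [qPoch_succ', zpow_neg, zpow_natCast, zpow_neg, zpow_natCast, hinv]
  have e2 : qPoch q (α * β * q ^ (n + 1 + 1)) (k + 1) = qPoch q (α * β * q ^ (n + 1)) k
      * (1 - α * β * q ^ (n + k + 1)) * (1 - α * β * q ^ (n + k + 2))
        / (1 - α * β * q ^ (n + 1)) := by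
    rw [eq_div_iff u, show α * β * q ^ (n + 1 + 1) = q * (α * β * q ^ (n + 1)) by ring, mul_comm,
      ← qPoch_succ', qPoch_succ, qPoch_succ]
    ring
  rw [racahBasis, racahBasis, racahBasis, e1, e2, qPoch_succ (q ^ (-(n : ℤ))),
    qPoch_succ (α * β * q ^ (n + 1)), qRacahA]
  rw [zpow_neg, zpow_natCast]
  generalize qPoch q (q ^ n)⁻¹ k = y1
  generalize qPoch q (α * β * q ^ (n + 1)) k = y2
  generalize h5 : 1 - α * β * q ^ (2 * n + 1) = d5 at *
  generalize h6 : 1 - α * β * q ^ (2 * n + 2) = d6 at *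
  generalize h7 : 1 - α * β * q ^ (n + 1) = d7 at *
  field_simp
  subst h5 h6 h7
  ring

/-- The counterpart of `qRacahA_mul_sub`: the denominator factor `1 - αβ q^{2n}` of `C_n`
cancels. -/
theorem RacahGeneric.qRacahC_mul_sub {N : ℕ} {α β γ δ : ℂ} (h : RacahGeneric q N α β γ δ)
    {n : ℕ} (hn : n ≤ N) (k : ℕ) :
    qRacahC q n α β γ δ * (racahBasis q (α * β) n (k + 1) - racahBasis q (α * β) (n - 1) (k + 1))
      = racahBasis q (α * β) n k * (q * (1 - β * q ^ n) * (γ - α * β * q ^ n)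
          * (δ - α * q ^ n) * (1 - q ^ (k + 1)) * (1 - q ^ k * (q ^ n)⁻¹)
          / (1 - α * β * q ^ (2 * n + 1))) := by
  have hq0 := h.q_ne
  rcases n with _ | n
  · rcases k with _ | k
    · simp [qRacahC_zero]
    · simp [qRacahC_zero, racahBasis_eq_zero hq0 (α * β) k.succ_pos]
  have w : 1 - α * β * q ^ (2 * n + 2) ≠ 0 :=
    sub_ne_zero.2 (h.αβ_pow _ (by simp; omega)).symm
  have u : 1 - (q ^ (n + 1))⁻¹ ≠ 0 :=
    sub_ne_zero.2 fun e => h.q_pow (n + 1) (by omega) (inv_eq_one.1 e.symm)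
  have hinv : q * (q ^ (n + 1))⁻¹ = (q ^ n)⁻¹ := by field_simp; ring
  have e1 : qPoch q (q ^ n)⁻¹ (k + 1) = qPoch q (q ^ (n + 1))⁻¹ k
      * (1 - q ^ k * (q ^ (n + 1))⁻¹) * (1 - q ^ k * (q ^ n)⁻¹) / (1 - (q ^ (n + 1))⁻¹) := by
    rw [eq_div_iff u, ← hinv, mul_comm, ← qPoch_succ', qPoch_succ, qPoch_succ]
    ring
  have e2 : qPoch q (α * β * q ^ (n + 1)) (k + 1)
      = (1 - α * β * q ^ (n + 1)) * qPoch q (α * β * q ^ (n + 1 + 1)) k := by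
    rw [qPoch_succ']; congr 2; ring
  rw [racahBasis, racahBasis, racahBasis, Nat.add_sub_cancel, qRacahC]
  simp only [zpow_neg, zpow_natCast]
  rw [e1, e2, qPoch_succ, qPoch_succ (α * β * q ^ (n + 1 + 1)),
    show 2 * (n + 1) = 2 * n + 2 by ring, show 2 * n + 2 + 1 = 2 * n + 3 by ring]
  generalize qPoch q (q ^ (n + 1))⁻¹ k = y1
  generalize qPoch q (α * β * q ^ (n + 1 + 1)) k = y2
  generalize h5 : 1 - α * β * q ^ (2 * n + 3) = d5 at *
  generalize h6 : 1 - α * β * q ^ (2 * n + 2) = d6 at *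
  have e3 : 1 - q ^ (n + 1) = -q ^ (n + 1) * (1 - (q ^ (n + 1))⁻¹) := by field_simp; ring
  rw [e3]
  generalize h7 : 1 - (q ^ (n + 1))⁻¹ = d7 at *
  field_simp
  subst h5 h6 h7
  field_simp
  ring

/-- The difference operator with coefficients `A_n`, `C_n` is bidiagonal on `φ_k`. -/
theorem RacahGeneric.racahBasis_recurrence {N : ℕ} {α β γ δ : ℂ} (h : RacahGeneric q N α β γ δ)
    {n : ℕ} (hn : n ≤ N) (k : ℕ) :
    qRacahA q n α β γ δ * (racahBasis q (α * β) (n + 1) (k + 1) - racahBasis q (α * β) n (k + 1))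
      - qRacahC q n α β γ δ
        * (racahBasis q (α * β) n (k + 1) - racahBasis q (α * β) (n - 1) (k + 1))
      = ((q ^ (k + 1))⁻¹ - 1) * (1 - γ * δ * q ^ (k + 2)) * racahBasis q (α * β) n (k + 1)
        - (q ^ (k + 1))⁻¹ * (1 - α * q ^ (k + 1)) * (1 - γ * q ^ (k + 1))
          * (1 - β * δ * q ^ (k + 1)) * (1 - q ^ (k + 1)) * racahBasis q (α * β) n k := by
  rw [h.qRacahA_mul_sub hn, h.qRacahC_mul_sub hn, racahBasis_succ h.q_ne, qRacahEig, zpow_neg,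
    zpow_natCast]
  have v : 1 - α * β * q ^ (2 * n + 1) ≠ 0 :=
    sub_ne_zero.2 (h.αβ_pow _ (by simp; omega)).symm
  have h3 := h.q_ne
  generalize racahBasis q (α * β) n k = y
  generalize h5 : 1 - α * β * q ^ (2 * n + 1) = d5 at *
  field_simp
  subst h5
  ring

end RacahBasis

/-! ### Recurrence relation and difference equation -/

section Recurrence

variable {q : ℂ} {N : ℕ} {α β γ δ : ℂ}

/-- The three-term recurrence relation of the `q`-Racah polynomials. For `n = N` the undefined
`R_{N+1}` is multiplied by `A_N = 0`, and the recurrence holds because `x ≤ N`. -/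
theorem RacahGeneric.recurrence (h : RacahGeneric q N α β γ δ) {n x : ℕ} (hn : n ≤ N)
    (hx : x ≤ N) :
    qRacahA q n α β γ δ * qRacah q (n + 1) x α β γ δ + qRacahB q n α β γ δ * qRacah q n x α β γ δ
      + qRacahC q n α β γ δ * qRacah q (n - 1) x α β γ δ
      = qRacahEig q x (γ * δ) * qRacah q n x α β γ δ := by
  have hq0 := h.q_ne
  set c : ℕ → ℂ := fun k => q ^ k / qPochs q [α * q, β * δ * q, γ * q, q] k with hc
  have hcs : ∀ k, k + 1 ≤ N → c k * q = c (k + 1) * ((1 - α * q ^ (k + 1))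
      * (1 - γ * q ^ (k + 1)) * (1 - β * δ * q ^ (k + 1)) * (1 - q ^ (k + 1))) := by
    intro k hk
    have n1 : 1 - α * q ^ (k + 1) ≠ 0 := sub_ne_zero.2 (h.α_pow _ (by simp; omega)).symm
    have n2 : 1 - γ * q ^ (k + 1) ≠ 0 := sub_ne_zero.2 (h.γ_pow _ (by simp; omega)).symm
    have n3 : 1 - β * δ * q ^ (k + 1) ≠ 0 := sub_ne_zero.2 (h.βδ_pow _ (by simp; omega)).symm
    have n4 : 1 - q ^ (k + 1) ≠ 0 := sub_ne_zero.2 (h.q_pow _ (by omega)).symm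
    simp only [hc, qPochs, List.map_cons, List.map_nil, List.prod_cons, List.prod_nil, qPoch_succ]
    rw [show 1 - q ^ k * (α * q) = 1 - α * q ^ (k + 1) by ring,
      show 1 - q ^ k * (γ * q) = 1 - γ * q ^ (k + 1) by ring,
      show 1 - q ^ k * (β * δ * q) = 1 - β * δ * q ^ (k + 1) by ring,
      show 1 - q ^ k * q = 1 - q ^ (k + 1) by ring]
    generalize h1 : 1 - α * q ^ (k + 1) = d1 at *
    generalize h2 : 1 - γ * q ^ (k + 1) = d2 at *
    generalize h3 : 1 - β * δ * q ^ (k + 1) = d3 at *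
    generalize h4 : 1 - q ^ (k + 1) = d4 at *
    field_simp
    ring
  set S : ℕ → ℂ := fun n => ∑ k ∈ Finset.range (N + 1),
    c k * racahBasis q (α * β) n k * racahBasis q (γ * δ) x k with hS
  have hR : ∀ m ≤ N, qRacah q m x α β γ δ = S m := fun m hm => qRacah_eq_sum hq0 hm x α β γ δ
  have hA : qRacahA q n α β γ δ * qRacah q (n + 1) x α β γ δ = qRacahA q n α β γ δ * S (n + 1) := by
    rcases hn.eq_or_lt with rfl | hn
    · simp [h.qRacahA_self]
    · rw [hR _ hn]
  -- the difference of both sides, expanded in the bases `φ_k`, telescopes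
  have key : ∀ m ≤ N, ∑ k ∈ Finset.range (m + 1), c k * racahBasis q (γ * δ) x k *
      (qRacahA q n α β γ δ * (racahBasis q (α * β) (n + 1) k - racahBasis q (α * β) n k)
        - qRacahC q n α β γ δ * (racahBasis q (α * β) n k - racahBasis q (α * β) (n - 1) k)
        - (qRacahEig q x (γ * δ) - 1 - γ * δ * q) * racahBasis q (α * β) n k)
      = (q ^ m)⁻¹ * c m * racahBasis q (γ * δ) x (m + 1) * racahBasis q (α * β) n m := by
    intro m
    induction m with
    | zero =>
      intro _
      simp only [zero_add, Finset.sum_range_one, racahBasis_zero_right, racahBasis_succ hq0]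
      simp
      left
      ring
    | succ m ih =>
      intro hm
      rw [Finset.sum_range_succ, ih (by omega), h.racahBasis_recurrence hn, racahBasis_succ hq0 _ x
        (m + 1), racahBasis_succ hq0 _ x m]
      have e : c m = c (m + 1) * ((1 - α * q ^ (m + 1))
        * (1 - γ * q ^ (m + 1)) * (1 - β * δ * q ^ (m + 1)) * (1 - q ^ (m + 1))) / q := by
        rw [eq_div_iff hq0, hcs m hm]
      rw [e]
      field_simp
      ring
  have fin := key N le_rfl
  rw [racahBasis_eq_zero hq0 (γ * δ) (Nat.lt_succ_of_le hx), mul_zero, zero_mul] at fin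
  rw [hA, hR n hn, hR (n - 1) (by omega), qRacahB, ← sub_eq_zero, ← fin]
  simp only [hS, Finset.mul_sum, ← Finset.sum_add_distrib, ← Finset.sum_sub_distrib]
  refine Finset.sum_congr rfl fun k _ => ?_
  ring

/-- The `q`-difference equation of the `q`-Racah polynomials, dual to the recurrence relation. -/
theorem RacahGeneric.difference (h : RacahGeneric q N α β γ δ) {n x : ℕ} (hn : n ≤ N)
    (hx : x ≤ N) :
    qRacahA q x γ δ α β * qRacah q n (x + 1) α β γ δ + qRacahB q x γ δ α β * qRacah q n x α β γ δ
      + qRacahC q x γ δ α β * qRacah q n (x - 1) α β γ δ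
      = qRacahEig q n (α * β) * qRacah q n x α β γ δ := by
  have := h.symm.recurrence hx hn
  simpa only [qRacah_swap h.q_ne _ _ γ δ α β] using this

theorem RacahGeneric.qRacahA_ne_zero (h : RacahGeneric q N α β γ δ) {n : ℕ} (hn : n < N) :
    qRacahA q n α β γ δ ≠ 0 := by
  rw [qRacahA]
  refine div_ne_zero (mul_ne_zero (mul_ne_zero (mul_ne_zero ?_ ?_) ?_) ?_) (mul_ne_zero ?_ ?_)
    <;> refine sub_ne_zero.2 (Ne.symm ?_)
  · exact h.α_pow _ (by simp; omega)
  · exact h.αβ_pow _ (by simp; omega)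
  · exact h.βδ_pow _ (by simp; omega)
  · exact h.γ_pow _ (by simp; omega)
  · exact h.αβ_pow _ (by simp; omega)
  · exact h.αβ_pow _ (by simp; omega)

theorem RacahGeneric.qRacahC_ne_zero (h : RacahGeneric q N α β γ δ) {n : ℕ} (h0 : 0 < n)
    (hn : n ≤ N) : qRacahC q n α β γ δ ≠ 0 := by
  rw [qRacahC]
  refine div_ne_zero (mul_ne_zero (mul_ne_zero (mul_ne_zero (mul_ne_zero h.q_ne ?_) ?_) ?_) ?_)
    (mul_ne_zero ?_ ?_) <;> refine sub_ne_zero.2 (Ne.symm ?_)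
  · exact h.q_pow _ h0
  · exact h.β_pow _ (by simp; omega)
  · exact h.αβγ_pow _ (by simp; omega)
  · exact h.αδ_pow _ (by simp; omega)
  · exact h.αβ_pow _ (by simp; omega)
  · exact h.αβ_pow _ (by simp; omega)

theorem RacahGeneric.qRacahEig_injective (h : RacahGeneric q N α β γ δ) {x y : ℕ} (hx : x ≤ N)
    (hy : y ≤ N) (hxy : x ≠ y) : qRacahEig q x (γ * δ) ≠ qRacahEig q y (γ * δ) := by
  have hq0 := h.q_ne
  wlog hlt : x < y generalizing x y
  · exact (this hy hx hxy.symm (by omega)).symm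
  obtain ⟨m, rfl⟩ := Nat.exists_eq_add_of_lt hlt
  intro e
  have n1 : q ^ (m + 1) - 1 ≠ 0 := sub_ne_zero.2 (h.q_pow _ (by omega))
  have n2 : γ * δ * q ^ (2 * x + m + 2) - 1 ≠ 0 := sub_ne_zero.2 (h.γδ_pow _ (by simp; omega))
  refine mul_ne_zero (pow_ne_zero x hq0) (mul_ne_zero n1 n2) ?_
  rw [qRacahEig, qRacahEig, zpow_neg, zpow_neg, zpow_natCast, zpow_natCast] at e
  field_simp at e
  linear_combination -e

end Recurrence

/-! ### Orthogonality and norms -/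

section Orthogonality

variable {q : ℂ} {N : ℕ} {α β γ δ : ℂ}

theorem RacahGeneric.weight_zero (h : RacahGeneric q N α β γ δ) :
    qRacahWeight q 0 α β γ δ = 1 := by
  have : 1 - α * β * q ≠ 0 :=
    sub_ne_zero.2 (by simpa using (h.αβ_pow 1 (by simp)).symm)
  simp [qRacahWeight, qPochs, this]

/-- The weight symmetrises the recurrence relation. -/
theorem RacahGeneric.weight_succ (h : RacahGeneric q N α β γ δ) {n : ℕ} (hn : n < N) :
    qRacahWeight q (n + 1) α β γ δ * qRacahC q (n + 1) α β γ δ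
      = qRacahWeight q n α β γ δ * qRacahA q n α β γ δ := by
  have hq0 := h.q_ne
  have hγ := h.γ_ne
  have hδ := h.δ_ne
  have n1 : 1 - q ^ (n + 1) ≠ 0 := sub_ne_zero.2 (h.q_pow _ (by omega)).symm
  have n2 : γ - α * β * q ^ (n + 1) ≠ 0 := sub_ne_zero.2 (h.αβγ_pow _ (by simp; omega)).symm
  have n3 : δ - α * q ^ (n + 1) ≠ 0 := sub_ne_zero.2 (h.αδ_pow _ (by simp; omega)).symm
  have n4 : 1 - β * q ^ (n + 1) ≠ 0 := sub_ne_zero.2 (h.β_pow _ (by simp; omega)).symm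
  have n5 : 1 - α * β * q ^ (2 * n + 1) ≠ 0 :=
    sub_ne_zero.2 (h.αβ_pow _ (by simp; omega)).symm
  have n7 : 1 - α * β * q ^ (2 * n + 3) ≠ 0 :=
    sub_ne_zero.2 (h.αβ_pow _ (by simp; omega)).symm
  simp only [qRacahWeight, qRacahA, qRacahC, qPochs, List.map_cons, List.map_nil, List.prod_cons,
    List.prod_nil, qPoch_succ]
  rw [show 2 * (n + 1) = 2 * n + 2 by ring, show 2 * n + 2 + 1 = 2 * n + 3 by ring,
    show 1 - q ^ n * q = 1 - q ^ (n + 1) by ring,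
    show 1 - q ^ n * (α * β * q / γ) = (γ - α * β * q ^ (n + 1)) / γ by field_simp; ring,
    show 1 - q ^ n * (α * q / δ) = (δ - α * q ^ (n + 1)) / δ by field_simp; ring,
    show 1 - q ^ n * (β * q) = 1 - β * q ^ (n + 1) by ring]
  generalize qPoch q q n = w1
  generalize qPoch q (α * β * q / γ) n = w2
  generalize qPoch q (α * q / δ) n = w3
  generalize qPoch q (β * q) n = w4
  generalize h1 : 1 - q ^ (n + 1) = d1 at *
  generalize h2 : γ - α * β * q ^ (n + 1) = d2 at *
  generalize h3 : δ - α * q ^ (n + 1) = d3 at *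
  generalize h4 : 1 - β * q ^ (n + 1) = d4 at *
  generalize h5 : 1 - α * β * q ^ (2 * n + 1) = d5 at *
  generalize h6 : 1 - α * β * q ^ (2 * n + 2) = d6 at *
  generalize h7 : 1 - α * β * q ^ (2 * n + 3) = d7 at *
  field_simp
  ring

/-- Summation by parts: the recurrence operator is symmetric for the weighted bilinear form. -/
theorem RacahGeneric.sum_weight_symm (h : RacahGeneric q N α β γ δ) (f g : ℕ → ℂ) :
    ∑ i ∈ Finset.range (N + 1), qRacahWeight q i α β γ δ * (qRacahA q i α β γ δ * f (i + 1)
        + qRacahB q i α β γ δ * f i + qRacahC q i α β γ δ * f (i - 1)) * g i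
      = ∑ i ∈ Finset.range (N + 1), qRacahWeight q i α β γ δ * f i
        * (qRacahA q i α β γ δ * g (i + 1) + qRacahB q i α β γ δ * g i
          + qRacahC q i α β γ δ * g (i - 1)) := by
  rw [← sub_eq_zero, ← Finset.sum_sub_distrib]
  -- the partial sums of the difference are discrete Wronskians
  have key : ∀ m ≤ N, ∑ i ∈ Finset.range (m + 1),
      (qRacahWeight q i α β γ δ * (qRacahA q i α β γ δ * f (i + 1)
        + qRacahB q i α β γ δ * f i + qRacahC q i α β γ δ * f (i - 1)) * g i
      - qRacahWeight q i α β γ δ * f i * (qRacahA q i α β γ δ * g (i + 1)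
        + qRacahB q i α β γ δ * g i + qRacahC q i α β γ δ * g (i - 1)))
      = qRacahWeight q m α β γ δ * qRacahA q m α β γ δ * (f (m + 1) * g m - f m * g (m + 1)) := by
    intro m
    induction m with
    | zero => intro _; simp [qRacahC_zero]; ring
    | succ m ih =>
      intro hm
      rw [Finset.sum_range_succ, ih (by omega), Nat.add_sub_cancel]
      linear_combination (f m * g (m + 1) - g m * f (m + 1)) * h.weight_succ hm
  rw [key N le_rfl, h.qRacahA_self]
  ring

/-- Orthogonality of eigenvectors of a symmetric operator for distinct eigenvalues. -/
theorem RacahGeneric.orthogonal (h : RacahGeneric q N α β γ δ) {x y : ℕ} (hx : x ≤ N)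
    (hy : y ≤ N) (hxy : x ≠ y) :
    ∑ i ∈ Finset.range (N + 1),
      qRacahWeight q i α β γ δ * qRacah q i x α β γ δ * qRacah q i y α β γ δ = 0 := by
  have key := h.sum_weight_symm (fun i => qRacah q i x α β γ δ) (fun i => qRacah q i y α β γ δ)
  have h1 : ∀ i ∈ Finset.range (N + 1), i ≤ N := fun i hi => by simp at hi; omega
  refine (mul_eq_zero.1 ?_).resolve_left (sub_ne_zero.2 (h.qRacahEig_injective hx hy hxy))
  rw [sub_mul, sub_eq_zero, Finset.mul_sum, Finset.mul_sum]
  refine Eq.trans (Finset.sum_congr rfl fun i hi => ?_) (key.trans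
    (Finset.sum_congr rfl fun i hi => ?_))
  · rw [h.recurrence (h1 i hi) hx]
    ring
  · rw [h.recurrence (h1 i hi) hy]
    ring

/-- The total mass of the weight is a terminating `₆φ₅` series. -/
theorem RacahGeneric.mass_mul_sum_weight (h : RacahGeneric q N α β γ δ)
    (hγ : γ * q ^ (N + 1) = 1) :
    qRacahMassThd q N α β γ δ * ∑ i ∈ Finset.range (N + 1), qRacahWeight q i α β γ δ = 1 := by
  have hq0 := h.q_ne
  have hα := h.α_ne
  have hβ := h.β_ne
  have hδ := h.δ_ne
  have hγ0 := h.γ_ne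
  have hγq : γ * q = q ^ (-(N : ℤ)) := by
    rw [zpow_neg, zpow_natCast]
    refine eq_inv_of_mul_eq_one_left ?_
    rw [← hγ]; ring
  have hγ' : q ^ (N + 1) = 1 / γ := by field_simp; rw [← hγ]; ring
  have hw : ∀ i, qRacahWeight q i α β γ δ
      = sixPhiFiveTerm q (α * β * q) (α * q) (β * δ * q) N i := by
    intro i
    simp only [qRacahWeight, sixPhiFiveTerm, qPochs, List.map_cons, List.map_nil, List.prod_cons,
      List.prod_nil, hγ', ← hγq]
    rw [show α * β * q * q / (α * q) = β * q by field_simp,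
      show α * β * q * q / (β * δ * q) = α * q / δ by field_simp,
      show α * β * q * (1 / γ) = α * β * q / γ by ring,
      show α * β * q / γ / (α * q * (β * δ * q)) = (γ * δ * q)⁻¹ by field_simp, inv_pow]
    simp only [div_eq_mul_inv, mul_inv]
    ring
  have hs := sixPhiFive_sum hq0 h.q_pow (a := α * β * q) (b := α * q) (c := β * δ * q)
    (by simp [hα, hq0]) (by simp [hβ, hδ, hq0]) N
    (fun k hk e => h.αβ_pow (k + 1) (by simp; omega) (by rw [← e]; ring))
    (fun k hk e => h.β_pow k hk (by
      have : α * q * (β * q ^ k) = α * q * 1 := by linear_combination e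
      exact mul_left_cancel₀ (mul_ne_zero hα hq0) this))
    (fun k hk e => h.αδ_pow k hk (by
      have : β * q * (α * q ^ k) = β * q * δ := by linear_combination e
      exact mul_left_cancel₀ (mul_ne_zero hβ hq0) this))
  rw [Finset.sum_congr rfl fun i _ => hw i, hs, qRacahMassThd]
  have z1 : qPoch q (α * q / δ) N ≠ 0 := qPoch_ne_zero fun j hj e =>
    h.αδ_pow (j + 1) (by simp; omega) (by field_simp at e; rw [← e]; ring)
  have z2 : qPoch q (β * q) N ≠ 0 := qPoch_ne_zero fun j hj e =>
    h.β_pow (j + 1) (by simp; omega) (by rw [← e]; ring)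
  have z3 : qPoch q (α * β * q ^ 2) N ≠ 0 := qPoch_ne_zero fun j hj e =>
    h.αβ_pow (j + 2) (by simp; omega) (by rw [← e]; ring)
  have z4 : qPoch q (1 / δ) N ≠ 0 := qPoch_ne_zero fun j hj e => by
    -- `δ = q^j` is excluded since `γ δ q^{N+1-j} ≠ 1`
    refine h.γδ_pow (N + 1 - j) (by simp; omega) ?_
    have e : q ^ j = δ := by field_simp at e; exact e
    rw [← e, mul_assoc, ← pow_add, show j + (N + 1 - j) = N + 1 by omega, hγ]
  rw [show α * β * q * q / (α * q * (β * δ * q)) = 1 / δ by field_simp,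
    show α * β * q * q / (α * q) = β * q by field_simp,
    show α * β * q * q / (β * δ * q) = α * q / δ by field_simp,
    show α * β * q * q = α * β * q ^ 2 by ring]
  simp only [qPochs, List.map_cons, List.map_nil, List.prod_cons, List.prod_nil]
  generalize qPoch q (α * q / δ) N = w1 at *
  generalize qPoch q (β * q) N = w2 at *
  generalize qPoch q (α * β * q ^ 2) N = w3 at *
  generalize qPoch q (1 / δ) N = w4 at *
  field_simp

/-- Multiplication of one factor by `λ(i; αβ)` in the weighted bilinear form, rewritten by the
difference equation. -/
theorem RacahGeneric.sum_weight_eig (h : RacahGeneric q N α β γ δ) {x : ℕ} (hx : x ≤ N)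
    (g : ℕ → ℂ) :
    ∑ i ∈ Finset.range (N + 1),
        qRacahWeight q i α β γ δ * (qRacahEig q i (α * β) * qRacah q i x α β γ δ) * g i
      = qRacahA q x γ δ α β * ∑ i ∈ Finset.range (N + 1),
          qRacahWeight q i α β γ δ * qRacah q i (x + 1) α β γ δ * g i
        + qRacahB q x γ δ α β * ∑ i ∈ Finset.range (N + 1),
          qRacahWeight q i α β γ δ * qRacah q i x α β γ δ * g i
        + qRacahC q x γ δ α β * ∑ i ∈ Finset.range (N + 1),
          qRacahWeight q i α β γ δ * qRacah q i (x - 1) α β γ δ * g i := by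
  simp only [Finset.mul_sum, ← Finset.sum_add_distrib]
  refine Finset.sum_congr rfl fun i hi => ?_
  rw [← h.difference (by simp at hi; omega) hx]
  ring

/-- The squared norms of the `q`-Racah polynomials, for the orthogonality in the degree, are
the inverses of the dual weights, up to the total mass. -/
theorem RacahGeneric.norm (h : RacahGeneric q N α β γ δ) (hγ : γ * q ^ (N + 1) = 1) {x : ℕ}
    (hx : x ≤ N) :
    qRacahMassThd q N α β γ δ * qRacahWeight q x γ δ α β * ∑ i ∈ Finset.range (N + 1),
      qRacahWeight q i α β γ δ * qRacah q i x α β γ δ * qRacah q i x α β γ δ = 1 := by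
  induction x with
  | zero =>
    rw [h.symm.weight_zero, mul_one, ← h.mass_mul_sum_weight hγ]
    simp [qRacah_zero_right h.q_ne]
  | succ x ih =>
    rw [← ih (by omega), mul_assoc, mul_assoc]
    congr 1
    have hA := h.symm.qRacahA_ne_zero (show x < N by omega)
    have hw := h.symm.weight_succ (show x < N by omega)
    -- multiplication by `λ(i; αβ)`, applied to the polynomial of index `x` or to that of `x + 1`
    have e : qRacahA q x γ δ α β * ∑ i ∈ Finset.range (N + 1), qRacahWeight q i α β γ δ
          * qRacah q i (x + 1) α β γ δ * qRacah q i (x + 1) α β γ δ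
        = qRacahC q (x + 1) γ δ α β * ∑ i ∈ Finset.range (N + 1), qRacahWeight q i α β γ δ
          * qRacah q i x α β γ δ * qRacah q i x α β γ δ := by
      have s1 := h.sum_weight_eig (show x ≤ N by omega) (fun i => qRacah q i (x + 1) α β γ δ)
      have s2 := h.sum_weight_eig hx (fun i => qRacah q i x α β γ δ)
      have z1 : qRacahC q x γ δ α β * ∑ i ∈ Finset.range (N + 1), qRacahWeight q i α β γ δ
          * qRacah q i (x - 1) α β γ δ * qRacah q i (x + 1) α β γ δ = 0 := by
        rcases x.eq_zero_or_pos with rfl | hpos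
        · rw [qRacahC_zero, zero_mul]
        · rw [h.orthogonal (by omega) hx (by omega), mul_zero]
      have z2 : qRacahA q (x + 1) γ δ α β * ∑ i ∈ Finset.range (N + 1), qRacahWeight q i α β γ δ
          * qRacah q i (x + 1 + 1) α β γ δ * qRacah q i x α β γ δ = 0 := by
        rcases hx.eq_or_lt with rfl | hlt
        · rw [h.symm.qRacahA_self, zero_mul]
        · rw [h.orthogonal (by omega) (by omega) (by omega), mul_zero]
      beta_reduce at s1 s2
      rw [z1, h.orthogonal (x := x) (y := x + 1) (by omega) hx (by omega), mul_zero, add_zero,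
        add_zero] at s1
      rw [z2, h.orthogonal (x := x + 1) (y := x) hx (by omega) (by omega), mul_zero, zero_add,
        zero_add, Nat.add_sub_cancel] at s2
      rw [← s1, ← s2]
      exact Finset.sum_congr rfl fun i _ => by ring
    rw [← mul_right_inj' hA]
    linear_combination qRacahWeight q (x + 1) γ δ α β * e
      + (∑ i ∈ Finset.range (N + 1), qRacahWeight q i α β γ δ
          * qRacah q i x α β γ δ * qRacah q i x α β γ δ) * hw

end Orthogonality

/-! ### Connection between families with different fourth parameters -/

section Connection

variable {q : ℂ}

/-- The connection coefficients between the `q`-Racah polynomials with fourth parameters `δ` and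
`ε`, without the factor `connScale` that does not depend on `k`. -/
noncomputable def connCoeff (q β γ δ ε : ℂ) (n k : ℕ) : ℂ :=
  qPochs q [q ^ (-(n : ℤ)), γ * δ * q ^ (n + 1), γ * ε * q, β * ε * q] k
      * (1 - γ * ε * q ^ (2 * k + 1))
    / (qPochs q [q, γ * ε * q ^ (n + 2), ε * q * q ^ (-(n : ℤ)) / δ, γ * q / β] k
      * (1 - γ * ε * q)) * (1 / (β * δ)) ^ k

/-- The normalisation of the connection coefficients. -/
noncomputable def connScale (q β γ δ ε : ℂ) (n : ℕ) : ℂ :=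
  qPochs q [δ / ε, γ * q / β] n * (β * ε * q) ^ n / qPochs q [β * δ * q, γ * ε * q ^ 2] n

/-- The quotient `(q^{-(l+j)}; q)_l / (q; q)_{l+j}` under the shift of the summation index by
`l`. -/
theorem qPoch_neg_add (hq0 : q ≠ 0) (l j : ℕ) :
    qPoch q (q ^ (-((l + j : ℕ) : ℤ))) l * qPoch q q j * qPoch q q l * q ^ (l * j)
      = qPoch q (q ^ (-(l : ℤ))) l * qPoch q q (l + j) := by
  have h1 := qPoch_reverse hq0 (pow_ne_zero j hq0) l
  have h2 := qPoch_reverse hq0 one_ne_zero l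
  rw [show q ^ (-(l : ℤ)) / q ^ j = q ^ (-((l + j : ℕ) : ℤ)) by
    rw [zpow_neg, zpow_neg, zpow_natCast, zpow_natCast, pow_add, mul_inv, div_eq_mul_inv]] at h1
  rw [div_one, one_mul] at h2
  rw [h1, h2, add_comm l j, qPoch_add]
  have h3 : (∏ i ∈ Finset.range l, -(q ^ (i + 1) * q ^ j)⁻¹) * q ^ (l * j)
      = ∏ i ∈ Finset.range l, -(q ^ (i + 1) * 1)⁻¹ := by
    have hc : q ^ (l * j) = ∏ _i ∈ Finset.range l, q ^ j := by
      rw [Finset.prod_const, Finset.card_range, mul_comm, pow_mul]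
    rw [hc, ← Finset.prod_mul_distrib]
    refine Finset.prod_congr rfl fun i _ => ?_
    field_simp
  rw [← h3]
  ring

/-- Shifting the summation index by `l` turns the sum over the connection coefficients into a
very-well-poised series. -/
theorem connCoeff_mul_racahBasis (hq0 : q ≠ 0) (hq : ∀ k : ℕ, 0 < k → q ^ k ≠ 1)
    {β γ δ ε : ℂ} (hβ : β ≠ 0) (hγ : γ ≠ 0) (hδ : δ ≠ 0) (hε : ε ≠ 0) (l m j : ℕ)
    (h1 : 1 - γ * ε * q ^ (2 * l + 1) ≠ 0) :
    connCoeff q β γ δ ε (l + m) (l + j) * racahBasis q (γ * ε) (l + j) l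
      = connCoeff q β γ δ ε (l + m) l * racahBasis q (γ * ε) l l
        * sixPhiFiveTerm q (γ * ε * q ^ (2 * l + 1)) (γ * δ * q ^ (l + m + l + 1))
          (β * ε * q ^ (l + 1)) m j := by
  have e1 : qPoch q (q ^ (-((l + m : ℕ) : ℤ))) (l + j)
      = qPoch q (q ^ (-((l + m : ℕ) : ℤ))) l * qPoch q (q ^ (-(m : ℤ))) j := by
    rw [qPoch_add]
    congr 2
    rw [zpow_neg, zpow_neg, zpow_natCast, zpow_natCast]
    field_simp
    ring
  have e2 : qPoch q (γ * δ * q ^ (l + m + 1)) (l + j)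
      = qPoch q (γ * δ * q ^ (l + m + 1)) l * qPoch q (γ * δ * q ^ (l + m + l + 1)) j := by
    rw [qPoch_add]; congr 2; ring
  have e3 : qPoch q (β * ε * q) (l + j)
      = qPoch q (β * ε * q) l * qPoch q (β * ε * q ^ (l + 1)) j := by
    rw [qPoch_add]; congr 2; ring
  have e4 : qPoch q (γ * ε * q ^ (l + m + 2)) (l + j) = qPoch q (γ * ε * q ^ (l + m + 2)) l
      * qPoch q (γ * ε * q ^ (2 * l + 1) * q ^ (m + 1)) j := by
    rw [qPoch_add]; congr 2; ring
  have e5 : qPoch q (ε * q * q ^ (-((l + m : ℕ) : ℤ)) / δ) (l + j)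
      = qPoch q (ε * q * q ^ (-((l + m : ℕ) : ℤ)) / δ) l
        * qPoch q (γ * ε * q ^ (2 * l + 1) * q / (γ * δ * q ^ (l + m + l + 1))) j := by
    rw [qPoch_add]
    congr 2
    rw [zpow_neg, zpow_natCast]
    field_simp
    ring
  have e6 : qPoch q (γ * q / β) (l + j) = qPoch q (γ * q / β) l
      * qPoch q (γ * ε * q ^ (2 * l + 1) * q / (β * ε * q ^ (l + 1))) j := by
    rw [qPoch_add]
    congr 2
    field_simp
    ring
  have e7 : qPoch q (γ * ε * q) (l + j) * qPoch q (γ * ε * q ^ (l + j + 1)) l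
      = qPoch q (γ * ε * q) l * qPoch q (γ * ε * q ^ (l + 1)) l
        * qPoch q (γ * ε * q ^ (2 * l + 1)) j := by
    rw [show γ * ε * q ^ (l + j + 1) = q ^ (l + j) * (γ * ε * q) by ring, ← qPoch_add,
      show γ * ε * q ^ (l + 1) = q ^ l * (γ * ε * q) by ring, ← qPoch_add,
      show γ * ε * q ^ (2 * l + 1) = q ^ (l + l) * (γ * ε * q) by ring, ← qPoch_add]
    congr 1
    ring
  have e8 := qPoch_neg_add hq0 l j
  have e9 : (γ * ε * q ^ (2 * l + 1) * q ^ (m + 1)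
      / (γ * δ * q ^ (l + m + l + 1) * (β * ε * q ^ (l + 1)))) ^ j
      = (1 / (β * δ)) ^ j * (q ^ (l * j))⁻¹ := by
    rw [pow_mul, ← inv_pow, ← mul_pow]
    congr 1
    field_simp
    ring
  have n1 := qPoch_self_ne_zero hq l
  have n2 := qPoch_self_ne_zero hq j
  have n3 := qPoch_self_ne_zero hq (l + j)
  have e8' : qPoch q (q ^ (-((l + j : ℕ) : ℤ))) l / qPoch q q (l + j)
      = qPoch q (q ^ (-(l : ℤ))) l / (qPoch q q l * qPoch q q j) * (q ^ (l * j))⁻¹ := by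
    field_simp
    linear_combination e8
  simp only [connCoeff, racahBasis, sixPhiFiveTerm, qPochs, List.map_cons, List.map_nil,
    List.prod_cons, List.prod_nil, mul_one, e1, e2, e3, e4, e5, e6, e9]
  rw [show γ * ε * q ^ (2 * l + 1) * q ^ (2 * j) = γ * ε * q ^ (2 * (l + j) + 1) by ring,
    pow_add (1 / (β * δ)) l j]
  generalize qPoch q (q ^ (-((l + m : ℕ) : ℤ))) l = w1
  generalize qPoch q (γ * δ * q ^ (l + m + 1)) l = w2
  generalize qPoch q (β * ε * q) l = w3
  generalize qPoch q (γ * ε * q ^ (l + m + 2)) l = w4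
  generalize qPoch q (ε * q * q ^ (-((l + m : ℕ) : ℤ)) / δ) l = w5
  generalize qPoch q (γ * q / β) l = w6
  generalize qPoch q (q ^ (-(m : ℤ))) j = v1
  generalize qPoch q (γ * δ * q ^ (l + m + l + 1)) j = v2
  generalize qPoch q (β * ε * q ^ (l + 1)) j = v3
  generalize qPoch q (γ * ε * q ^ (2 * l + 1) * q ^ (m + 1)) j = v4
  generalize qPoch q (γ * ε * q ^ (2 * l + 1) * q / (γ * δ * q ^ (l + m + l + 1))) j = v5
  generalize qPoch q (γ * ε * q ^ (2 * l + 1) * q / (β * ε * q ^ (l + 1))) j = v6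
  generalize 1 - γ * ε * q ^ (2 * l + 1) = d1 at *
  generalize 1 - γ * ε * q ^ (2 * (l + j) + 1) = d2 at *
  generalize 1 - γ * ε * q = d3 at *
  generalize (1 / (β * δ)) ^ l = p1
  generalize (1 / (β * δ)) ^ j = p2
  calc _ = (qPoch q (γ * ε * q) (l + j) * qPoch q (γ * ε * q ^ (l + j + 1)) l)
        * (qPoch q (q ^ (-((l + j : ℕ) : ℤ))) l / qPoch q q (l + j))
        * (w1 * v1 * (w2 * v2) * (w3 * v3) * d2 * (w4 * v4 * (w5 * v5) * (w6 * v6) * d3)⁻¹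
          * (p1 * p2)) := by
        simp only [div_eq_mul_inv, mul_inv]; ring
    _ = _ := by
        rw [e7, e8']
        simp only [div_eq_mul_inv, mul_inv]
        have : d1 * d1⁻¹ = 1 := mul_inv_cancel₀ h1
        linear_combination ((-1) * (qPoch q (γ * ε * q) l * qPoch q (γ * ε * q ^ (l + 1)) l
        * qPoch q (γ * ε * q ^ (2 * l + 1)) j) *
        (qPoch q (q ^ (-(l : ℤ))) l * ((qPoch q q l)⁻¹ * (qPoch q q j)⁻¹) * (q ^ (l * j))⁻¹)
        * (w1 * v1 * (w2 * v2) * (w3 * v3) * d2 * (w4⁻¹ * v4⁻¹ * (w5⁻¹ * v5⁻¹) * (w6⁻¹ * v6⁻¹)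
          * d3⁻¹) * (p1 * p2))) * this

/-- The prefactors produced by `qPoch_reverse` for lengths `l + m`, `l` and `m`, compared with each
other. -/
theorem prod_neg_inv_shift (hq0 : q ≠ 0) {β δ ε : ℂ} (hβ : β ≠ 0) (hδ : δ ≠ 0) (hε : ε ≠ 0)
    (l m : ℕ) :
    ∏ j ∈ Finset.range (l + m), -(q ^ (j + 1) * (δ / (ε * q)))⁻¹
      = (β * ε * q) ^ (l + m) * (1 / (β * δ)) ^ l * (∏ j ∈ Finset.range l, -(q ^ (j + 1) * 1)⁻¹)
        * ∏ j ∈ Finset.range m, -(q ^ (j + 1) * (β * δ * q ^ l))⁻¹ := by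
  have h1 : ∏ j ∈ Finset.range l, -(q ^ (j + 1) * (δ / (ε * q)))⁻¹
      = ((β * ε * q) * (1 / (β * δ))) ^ l * ∏ j ∈ Finset.range l, -(q ^ (j + 1) * 1)⁻¹ := by
    rw [← Finset.card_range l, ← Finset.prod_const, Finset.card_range, ← Finset.prod_mul_distrib]
    refine Finset.prod_congr rfl fun j _ => ?_
    field_simp
  have h2 : ∏ j ∈ Finset.range m, -(q ^ (l + j + 1) * (δ / (ε * q)))⁻¹
      = (β * ε * q) ^ m * ∏ j ∈ Finset.range m, -(q ^ (j + 1) * (β * δ * q ^ l))⁻¹ := by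
    rw [← Finset.card_range m, ← Finset.prod_const, Finset.card_range, ← Finset.prod_mul_distrib]
    refine Finset.prod_congr rfl fun j _ => ?_
    field_simp
    ring
  rw [Finset.prod_range_add, h1, h2, pow_add, mul_pow]
  ring

theorem connCoeff_eq_zero (hq0 : q ≠ 0) (β γ δ ε : ℂ) {n k : ℕ} (h : n < k) :
    connCoeff q β γ δ ε n k = 0 := by
  simp only [connCoeff, qPochs, List.map_cons, List.prod_cons, qPoch_neg_eq_zero hq0 h, zero_mul,
    zero_div]

/-- Expansion of `φ_l(n) = (q^{-n}, γδ q^{n+1}; q)_l` in the `φ_l(k) = (q^{-k}, γε q^{k+1}; q)_l`,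
an instance of the `₆φ₅` summation. -/
theorem sum_connCoeff_mul_racahBasis {N : ℕ} {α β γ δ ε : ℂ} (h : RacahGeneric q N α β γ δ)
    (h' : RacahGeneric q N α β γ ε) (hδε : ∀ k < N, δ * q ^ k ≠ ε) {l m : ℕ} (hn : l + m ≤ N) :
    connScale q β γ δ ε (l + m) * ∑ k ∈ Finset.range (l + m + 1),
        connCoeff q β γ δ ε (l + m) k * racahBasis q (γ * ε) k l
      = qPoch q (β * ε * q) l / qPoch q (β * δ * q) l * racahBasis q (γ * δ) (l + m) l := by
  have hq0 := h.q_ne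
  have hβ := h.β_ne
  have hγ := h.γ_ne
  have hδ := h.δ_ne
  have hε := h'.δ_ne
  have n1 : 1 - γ * ε * q ^ (2 * l + 1) ≠ 0 :=
    sub_ne_zero.2 (h'.γδ_pow _ (by simp; omega)).symm
  have n2 : 1 - γ * ε * q ≠ 0 :=
    sub_ne_zero.2 (by simpa using (h'.γδ_pow 1 (by simp)).symm)
  rw [add_assoc, Finset.sum_range_add, Finset.sum_eq_zero (s := Finset.range l) fun k hk => by
    rw [racahBasis_eq_zero hq0 _ (Finset.mem_range.1 hk), mul_zero], zero_add]
  rw [Finset.sum_congr rfl fun j _ =>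
    connCoeff_mul_racahBasis hq0 h.q_pow hβ hγ hδ hε l m j n1, ← Finset.mul_sum]
  rw [sixPhiFive_sum hq0 h.q_pow (by simp [hγ, hδ, hq0]) (by simp [hβ, hε, hq0]) m
    (fun k hk e => h'.γδ_pow (2 * l + 1 + k) (by simp; omega) (by rw [← e]; ring))
    (fun k hk e => hδε (m - k) (by simp at hk; omega) (by
      obtain ⟨r, rfl⟩ := Nat.exists_eq_add_of_le (Finset.mem_Icc.1 hk).2
      rw [Nat.add_sub_cancel_left]
      have : γ * q ^ (2 * l + 1 + k) * (δ * q ^ r) = γ * q ^ (2 * l + 1 + k) * ε := by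
        linear_combination -e
      exact mul_left_cancel₀ (mul_ne_zero hγ (pow_ne_zero _ hq0)) this))
    (fun k hk e => h.γβ_pow (l + k) (by simp at hk ⊢; omega) (by
      have : ε * q ^ (l + 1) * (γ * q ^ (l + k)) = ε * q ^ (l + 1) * β := by
        linear_combination e
      exact mul_left_cancel₀ (mul_ne_zero hε (pow_ne_zero _ hq0)) this))]
  -- the evaluation of the series, split into Pochhammer symbols of length `l` and `m`
  have r1 := qPoch_reverse hq0 (y := δ / (ε * q)) (by simp [hδ, hε, hq0]) (l + m)
  have r2 := qPoch_reverse hq0 (y := 1) one_ne_zero l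
  have r3 := qPoch_reverse hq0 (y := β * δ * q ^ l) (by simp [hβ, hδ, hq0]) m
  rw [prod_neg_inv_shift hq0 hβ hδ hε,
    show q ^ (-((l + m : ℕ) : ℤ)) / (δ / (ε * q)) = ε * q * q ^ (-((l + m : ℕ) : ℤ)) / δ by
      field_simp, show δ / (ε * q) * q = δ / ε by field_simp] at r1
  rw [div_one, one_mul] at r2
  have e1 : q ^ (-(m : ℤ)) / (β * δ * q ^ l) = γ * ε * q ^ (2 * l + 1) * q
      / (γ * δ * q ^ (l + m + l + 1) * (β * ε * q ^ (l + 1))) := by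
    rw [zpow_neg, zpow_natCast]
    field_simp
    ring
  have e2 : qPoch q (ε * q * q ^ (-((l + m : ℕ) : ℤ)) / δ) (l + m)
      = qPoch q (ε * q * q ^ (-((l + m : ℕ) : ℤ)) / δ) l
        * qPoch q (γ * ε * q ^ (2 * l + 1) * q / (γ * δ * q ^ (l + m + l + 1))) m := by
    rw [qPoch_add]
    congr 2
    rw [zpow_neg, zpow_natCast]
    field_simp
    ring
  have e3 : qPoch q (γ * q / β) (l + m) = qPoch q (γ * q / β) l
      * qPoch q (γ * ε * q ^ (2 * l + 1) * q / (β * ε * q ^ (l + 1))) m := by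
    rw [qPoch_add]
    congr 2
    field_simp
    ring
  have e4 : qPoch q (β * δ * q) (l + m)
      = qPoch q (β * δ * q) l * qPoch q (β * δ * q ^ l * q) m := by
    rw [qPoch_add]; congr 2; ring
  have e5 : qPoch q (γ * ε * q) l * qPoch q (γ * ε * q ^ (l + 1)) l
      * (1 - γ * ε * q ^ (2 * l + 1)) * qPoch q (γ * ε * q ^ (2 * l + 1) * q) m
      = (1 - γ * ε * q) * qPoch q (γ * ε * q ^ 2) (l + m)
        * qPoch q (γ * ε * q ^ (l + m + 2)) l := by
    rw [show γ * ε * q ^ (l + 1) = q ^ l * (γ * ε * q) by ring, ← qPoch_add,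
      show γ * ε * q ^ (2 * l + 1) = q ^ (l + l) * (γ * ε * q) by ring, ← qPoch_succ,
      show q ^ (l + l) * (γ * ε * q) * q = q ^ (l + l + 1) * (γ * ε * q) by ring, ← qPoch_add,
      show γ * ε * q ^ 2 = q * (γ * ε * q) by ring,
      show γ * ε * q ^ (l + m + 2) = q ^ (l + m) * (q * (γ * ε * q)) by ring,
      mul_assoc (1 - γ * ε * q),
      ← qPoch_add, ← qPoch_succ']
    congr 1
    ring
  rw [← e1]
  have nw : qPoch q (δ / ε) (l + m) ≠ 0 := qPoch_ne_zero fun j hj e =>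
    hδε j (by omega) (by field_simp at e; rw [← e]; ring)
  have nr1 : qPoch q (ε * q * q ^ (-((l + m : ℕ) : ℤ)) / δ) (l + m) ≠ 0 := by
    rw [r1]
    refine mul_ne_zero (mul_ne_zero (mul_ne_zero (mul_ne_zero ?_ ?_) ?_) ?_) nw
    · exact pow_ne_zero _ (by simp [hβ, hε, hq0])
    · exact pow_ne_zero _ (by simp [hβ, hδ])
    · exact Finset.prod_ne_zero_iff.2 fun j _ => by simp [hq0]
    · exact Finset.prod_ne_zero_iff.2 fun j _ => by simp [hq0, hβ, hδ]
  have ng : qPoch q (γ * q / β) (l + m) ≠ 0 := qPoch_ne_zero fun j hj e =>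
    h.γβ_pow (j + 1) (by simp; omega) (by field_simp at e; rw [← e]; ring)
  have nb : qPoch q (β * δ * q) (l + m) ≠ 0 := qPoch_ne_zero fun j hj e =>
    h.βδ_pow (j + 1) (by simp; omega) (by rw [← e]; ring)
  have nc : qPoch q (γ * ε * q ^ 2) (l + m) ≠ 0 := qPoch_ne_zero fun j hj e =>
    h'.γδ_pow (j + 2) (by simp; omega) (by rw [← e]; ring)
  have nd : qPoch q (γ * ε * q ^ (l + m + 2)) l ≠ 0 := qPoch_ne_zero fun j hj e =>
    h'.γδ_pow (j + l + m + 2) (by simp; omega) (by rw [← e]; ring)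
  have nq := qPoch_self_ne_zero h.q_pow l
  simp only [connCoeff, connScale, racahBasis, qPochs, List.map_cons, List.map_nil,
    List.prod_cons, List.prod_nil, mul_one]
  rw [e2] at r1 nr1
  rw [e3, e4, r2, r3]
  rw [e3] at ng
  rw [e4] at nb
  generalize qPoch q (q ^ (-((l + m : ℕ) : ℤ))) l = w1 at *
  generalize qPoch q (γ * δ * q ^ (l + m + 1)) l = w2 at *
  generalize qPoch q (β * ε * q) l = w3 at *
  generalize qPoch q (γ * ε * q ^ (l + m + 2)) l = w4 at *
  generalize qPoch q (ε * q * q ^ (-((l + m : ℕ) : ℤ)) / δ) l = w5 at *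
  generalize qPoch q (γ * q / β) l = w6 at *
  generalize qPoch q (γ * ε * q ^ (2 * l + 1) * q / (γ * δ * q ^ (l + m + l + 1))) m = v5 at *
  generalize qPoch q (γ * ε * q ^ (2 * l + 1) * q / (β * ε * q ^ (l + 1))) m = v6 at *
  generalize qPoch q (γ * ε * q ^ (2 * l + 1) * q) m = v7 at *
  generalize qPoch q (γ * ε * q) l = u1 at *
  generalize qPoch q (γ * ε * q ^ (l + 1)) l = u2 at *
  generalize qPoch q (γ * ε * q ^ 2) (l + m) = u3 at *
  generalize qPoch q (β * δ * q) l = u4 at *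
  generalize qPoch q (β * δ * q ^ l * q) m = u5 at *
  generalize qPoch q (δ / ε) (l + m) = u6 at *
  generalize (1 / (β * δ)) ^ l = p1 at *
  generalize (β * ε * q) ^ (l + m) = p2 at *
  generalize 1 - γ * ε * q ^ (2 * l + 1) = d1 at *
  generalize 1 - γ * ε * q = d3 at *
  generalize ∏ j ∈ Finset.range l, -(q ^ (j + 1) * 1)⁻¹ = s1 at *
  generalize ∏ j ∈ Finset.range m, -(q ^ (j + 1) * (β * δ * q ^ l))⁻¹ = s2 at *
  generalize qPoch q q l = u7 at *
  have ⟨a1, a2⟩ := mul_ne_zero_iff.1 nr1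
  have ⟨a3, a4⟩ := mul_ne_zero_iff.1 ng
  have ⟨a5, a6⟩ := mul_ne_zero_iff.1 nb
  clear e1 e2 e3 e4 r2 r3 nr1 ng nb
  field_simp
  linear_combination w1 * w2 * w3 * (p2 * p1 * u6 * s1 * s2 * e5 - d3 * u3 * w4 * r1)

/-- The connection formula between `q`-Racah polynomials whose fourth parameters differ. -/
theorem qRacah_eq_sum_connCoeff {N : ℕ} {α β γ δ ε : ℂ} (h : RacahGeneric q N α β γ δ)
    (h' : RacahGeneric q N α β γ ε) (hδε : ∀ k < N, δ * q ^ k ≠ ε) {i n : ℕ} (hi : i ≤ N)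
    (hn : n ≤ N) :
    qRacah q i n α β γ δ = connScale q β γ δ ε n * ∑ k ∈ Finset.range (N + 1),
      connCoeff q β γ δ ε n k * qRacah q i k α β γ ε := by
  have hq0 := h.q_ne
  have e1 : ∑ k ∈ Finset.range (N + 1), connCoeff q β γ δ ε n k * qRacah q i k α β γ ε
      = ∑ k ∈ Finset.range (n + 1), connCoeff q β γ δ ε n k * qRacah q i k α β γ ε := by
    rw [← Finset.sum_subset (Finset.range_subset_range.2 (Nat.succ_le_succ hn))]
    intro k _ hk
    rw [connCoeff_eq_zero hq0 _ _ _ _ (by simpa using hk), zero_mul]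
  rw [e1, qRacah_eq_sum hq0 hi]
  simp only [qRacah_eq_sum hq0 hi _ _ _ _ ε, Finset.mul_sum]
  rw [Finset.sum_comm]
  refine Finset.sum_congr rfl fun l hl => ?_
  have hl : l ≤ N := by simp at hl; omega
  have nb : qPoch q (β * ε * q) l ≠ 0 := qPoch_ne_zero fun j hj e =>
    h'.βδ_pow (j + 1) (by simp; omega) (by rw [← e]; ring)
  have key : connScale q β γ δ ε n * ∑ k ∈ Finset.range (n + 1),
      connCoeff q β γ δ ε n k * racahBasis q (γ * ε) k l
      = qPoch q (β * ε * q) l / qPoch q (β * δ * q) l * racahBasis q (γ * δ) n l := by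
    rcases lt_or_ge n l with hnl | hnl
    · rw [racahBasis_eq_zero hq0 _ hnl, Finset.sum_eq_zero fun k hk => by
        rw [racahBasis_eq_zero hq0 _ (show k < l by simp at hk; omega), mul_zero]]
      simp
    · obtain ⟨m, rfl⟩ := Nat.exists_eq_add_of_le hnl
      exact sum_connCoeff_mul_racahBasis h h' hδε hn
  calc _ = q ^ l / (qPoch q (α * q) l * qPoch q (γ * q) l * qPoch q q l * qPoch q (β * ε * q) l)
        * racahBasis q (α * β) i l
        * (qPoch q (β * ε * q) l / qPoch q (β * δ * q) l * racahBasis q (γ * δ) n l) := by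
        simp only [qPochs, List.map_cons, List.map_nil, List.prod_cons, List.prod_nil,
          div_eq_mul_inv, mul_inv]
        linear_combination (-1) * (q ^ l * ((qPoch q (α * q) l)⁻¹ * (qPoch q (γ * q) l)⁻¹
          * (qPoch q q l)⁻¹) * racahBasis q (α * β) i l * (qPoch q (β * δ * q) l)⁻¹
          * racahBasis q (γ * δ) n l) * mul_inv_cancel₀ nb
    _ = _ := by
        rw [← key, Finset.mul_sum, Finset.mul_sum]
        refine Finset.sum_congr rfl fun k _ => ?_
        simp only [qPochs, List.map_cons, List.map_nil, List.prod_cons, List.prod_nil,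
          div_eq_mul_inv, mul_inv]
        ring

/-- The bilinear sum of two families of `q`-Racah polynomials, diagonalised by expanding both
in the family that is orthogonal with respect to the weight. -/
theorem mass_mul_sum_weight_qRacah {N : ℕ} {α β γ δ δ' ε : ℂ} (h : RacahGeneric q N α β γ δ)
    (h' : RacahGeneric q N α β γ δ') (hε : RacahGeneric q N α β γ ε)
    (hδε : ∀ k < N, δ * q ^ k ≠ ε) (hδε' : ∀ k < N, δ' * q ^ k ≠ ε)
    (hγ : γ * q ^ (N + 1) = 1) {n x : ℕ} (hn : n ≤ N) (hx : x ≤ N) :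
    qRacahMassThd q N α β γ ε * ∑ i ∈ Finset.range (N + 1),
        qRacahWeight q i α β γ ε * qRacah q i x α β γ δ' * qRacah q i n α β γ δ
      = connScale q β γ δ' ε x * connScale q β γ δ ε n * ∑ k ∈ Finset.range (N + 1),
        connCoeff q β γ δ' ε x k * connCoeff q β γ δ ε n k / qRacahWeight q k γ ε α β := by
  have e1 : ∀ i ∈ Finset.range (N + 1),
      qRacahWeight q i α β γ ε * qRacah q i x α β γ δ' * qRacah q i n α β γ δ
      = ∑ k ∈ Finset.range (N + 1), ∑ m ∈ Finset.range (N + 1),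
        (connScale q β γ δ' ε x * connScale q β γ δ ε n
          * (connCoeff q β γ δ' ε x k * connCoeff q β γ δ ε n m))
          * (qRacahWeight q i α β γ ε * qRacah q i k α β γ ε * qRacah q i m α β γ ε) := by
    intro i hi
    have hi : i ≤ N := by simp at hi; omega
    rw [qRacah_eq_sum_connCoeff h hε hδε hi hn, qRacah_eq_sum_connCoeff h' hε hδε' hi hx]
    simp only [Finset.mul_sum, Finset.sum_mul]
    rw [Finset.sum_comm]
    exact Finset.sum_congr rfl fun k _ => Finset.sum_congr rfl fun m _ => by ring
  rw [Finset.sum_congr rfl e1, Finset.sum_comm, Finset.mul_sum, Finset.mul_sum]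
  refine Finset.sum_congr rfl fun k hk => ?_
  have hk' : k ≤ N := by simp at hk; omega
  rw [Finset.sum_comm]
  simp only [← Finset.mul_sum]
  rw [Finset.sum_eq_single_of_mem k hk fun m hm hmk => by
    rw [hε.orthogonal hk' (by simp at hm; omega) hmk.symm, mul_zero]]
  have hnorm := hε.norm hγ hk'
  have : qRacahWeight q k γ ε α β ≠ 0 := fun e => by simp [e] at hnorm
  rw [mul_div_assoc', eq_div_iff this]
  linear_combination (connScale q β γ δ' ε x * connScale q β γ δ ε n
    * (connCoeff q β γ δ' ε x k * connCoeff q β γ δ ε n k)) * hnorm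

end Connection

/-! ### Nondegenerate parameters -/

section Parameters

variable {q : ℂ}

/-- The conditions on a `q`-Racah family with third parameter `q^{-N-1}` that imply all others. -/
theorem RacahGeneric.of_γ {N : ℕ} {α β γ δ : ℂ} (hq0 : q ≠ 0)
    (hq : ∀ k : ℕ, 0 < k → q ^ k ≠ 1) (hα : α ≠ 0) (hβ : β ≠ 0) (hδ : δ ≠ 0)
    (hγ : γ * q ^ (N + 1) = 1) (h1 : ∀ k ∈ Finset.Icc 1 N, α * q ^ k ≠ 1)
    (h2 : ∀ k ∈ Finset.Icc 1 N, β * q ^ k ≠ 1) (h3 : ∀ k ∈ Finset.Icc 1 N, β * δ * q ^ k ≠ 1)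
    (h4 : ∀ k ∈ Finset.Icc 1 N, α * q ^ k ≠ δ)
    (h5 : ∀ k ∈ Finset.Icc 1 (2 * N + 1), α * β * q ^ k ≠ 1)
    (h6 : ∀ k ∈ Finset.Icc 1 (2 * N + 1), γ * δ * q ^ k ≠ 1) : RacahGeneric q N α β γ δ where
  q_ne := hq0
  q_pow := hq
  α_ne := hα
  β_ne := hβ
  γ_ne := fun h => by simp [h] at hγ
  δ_ne := hδ
  α_pow := h1
  β_pow := h2
  γ_pow k hk e := by
    obtain ⟨r, rfl⟩ := Nat.exists_eq_add_of_le (Finset.mem_Icc.1 hk).2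
    refine hq (r + 1) (by omega) ?_
    rw [show k + r + 1 = k + (r + 1) by ring, pow_add, ← mul_assoc, e, one_mul] at hγ
    exact hγ
  δ_pow k hk e := h6 (k + N + 1) (by simp at hk ⊢; omega) (by
    linear_combination γ * q ^ (N + 1) * e + hγ)
  βδ_pow := h3
  αδ_pow := h4
  γβ_pow k hk e := by
    obtain ⟨r, rfl⟩ := Nat.exists_eq_add_of_le (Finset.mem_Icc.1 hk).2
    exact h2 (r + 1) (by simp at hk ⊢; omega) (by rw [← e, ← hγ]; ring)
  αβγ_pow k hk e := h5 (k + N + 1) (by simp at hk ⊢; omega) (by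
    linear_combination q ^ (N + 1) * e + hγ)
  γδα_pow k hk e := by
    obtain ⟨r, rfl⟩ := Nat.exists_eq_add_of_le (Finset.mem_Icc.1 hk).2
    exact h4 (r + 1) (by simp at hk ⊢; omega) (by
      linear_combination (-q ^ (r + 1)) * e + δ * hγ)
  αβ_pow := h5
  γδ_pow := h6
  cut := Or.inr hγ

/-- Nondegeneracy of the parameters of the trio: those of the three `q`-Racah families with fourth
parameters `δ`, `α/(βδ)` and `αs`, and the conditions for passing between them. -/
structure TrioGeneric (q : ℂ) (N : ℕ) (α β γ δ s : ℂ) : Prop where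
  cut : γ * q ^ (N + 1) = 1
  s_ne : s ≠ 0
  fst : RacahGeneric q N α β γ δ
  snd : RacahGeneric q N α β γ (α / (β * δ))
  mid : RacahGeneric q N α β γ (α * s)
  δ_pow_ne : ∀ k < N, δ * q ^ k ≠ α * s
  δ'_pow_ne : ∀ k < N, α / (β * δ) * q ^ k ≠ α * s

end Parameters

/-! ### The three operators in coordinates -/

section Operators

variable {q : ℂ} {N : ℕ} {α β γ δ s : ℂ}

/-- The action of a tridiagonal row, with entries `c`, `b`, `a` at `j - 1`, `j`, `j + 1`, on a
function of the index. The entries outside `0, …, N` vanish, so the values `F (N + 1)` and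
`F (0 - 1) = F 0` that formally occur at the ends do not matter. -/
theorem sum_tridiagonal (g : Fin (N + 1) → ℂ) (F : ℕ → ℂ) {j : ℕ} (hj : j ≤ N) {a b c : ℂ}
    (ha : ∀ i : Fin (N + 1), (i : ℕ) = j + 1 → g i = a) (ha' : j = N → a = 0)
    (hb : ∀ i : Fin (N + 1), (i : ℕ) = j → g i = b)
    (hc : ∀ i : Fin (N + 1), (i : ℕ) + 1 = j → g i = c) (hc' : j = 0 → c = 0)
    (h0 : ∀ i : Fin (N + 1), (i : ℕ) + 1 < j ∨ j + 1 < i → g i = 0) :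
    ∑ i, g i * F i = a * F (j + 1) + b * F j + c * F (j - 1) := by
  have e : ∀ i : Fin (N + 1), g i * F i = (if (i : ℕ) = j + 1 then a * F (j + 1) else 0)
      + (if (i : ℕ) = j then b * F j else 0) + (if (i : ℕ) + 1 = j then c * F (j - 1) else 0) := by
    intro i
    rcases lt_trichotomy ((i : ℕ) + 1) j with h | h | h
    · rw [h0 i (Or.inl h), if_neg (by omega), if_neg (by omega), if_neg (by omega)]; ring
    · rw [hc i h, if_neg (by omega), if_neg (by omega), if_pos h, ← h, Nat.add_sub_cancel]; ring
    · rcases lt_trichotomy ((i : ℕ)) (j + 1) with h' | h' | h'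
      · have h'' : (i : ℕ) = j := by omega
        rw [hb i h'', if_neg (by omega), if_pos h'', if_neg (by omega), h'']; ring
      · rw [ha i h', if_pos h', if_neg (by omega), if_neg (by omega), h']; ring
      · rw [h0 i (Or.inr h'), if_neg (by omega), if_neg (by omega), if_neg (by omega)]; ring
  simp only [e, Finset.sum_add_distrib]
  rw [Fin.sum_univ_eq_sum_range (fun i => if i = j + 1 then a * F (j + 1) else 0),
    Fin.sum_univ_eq_sum_range (fun i => if i = j then b * F j else 0),
    Fin.sum_univ_eq_sum_range (fun i => if i + 1 = j then c * F (j - 1) else 0)]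
  rw [Finset.sum_ite_eq', Finset.sum_ite_eq', if_pos (show j ∈ Finset.range (N + 1) by simp; omega)]
  congr 1
  · congr 1
    rcases hj.eq_or_lt with h | h
    · simp [ha' h]
    · rw [if_pos (by simp; omega)]
  · rcases j with _ | j
    · simp [hc' rfl]
    · simp only [Nat.add_right_cancel_iff]
      rw [Finset.sum_ite_eq', if_pos (by simp; omega)]

/-- The operator `qRacahOp` as a three-term recurrence on functions of `i`; at the ends
`A_N = 0` and `C_0 = 0`. -/
theorem RacahGeneric.qRacahOp_apply (h : RacahGeneric q N α β γ δ) (ν F : ℕ → ℂ)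
    (j : Fin (N + 1)) :
    qRacahOp q N α β γ δ ν (fun i => F i) j
      = qRacahA q j α β γ δ * (1 / ν (j + 1)) * F (j + 1) + qRacahB q j α β γ δ * F j
        + qRacahC q j α β γ δ * ν j * F (j - 1) := by
  rw [qRacahOp, Matrix.toLin'_apply]
  simp only [Matrix.mulVec, dotProduct, Matrix.of_apply]
  refine sum_tridiagonal _ F (by omega) ?_ ?_ ?_ ?_ ?_ ?_
  · intro i hi
    rw [if_neg (by omega), if_neg (by intro e; rw [e] at hi; omega), if_pos hi.symm, hi]
  · intro e; rw [e, h.qRacahA_self, zero_mul]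
  · intro i hi
    have hi : i = j := Fin.ext hi
    rw [if_neg (by omega), if_pos hi.symm, hi]
  · intro i hi
    rw [if_pos hi.symm]
  · intro e; rw [e, qRacahC_zero, zero_mul]
  · intro i hi
    rw [if_neg (by omega), if_neg (by intro e; rw [e] at hi; omega), if_neg (by omega)]

/-- The recurrence relation, read as the eigenvalue equation of `V`. -/
theorem RacahGeneric.trioV_apply (h : RacahGeneric q N α β γ δ) {n : ℕ} (hn : n ≤ N) :
    trioV q N α β γ δ (trioVecV q N α β γ δ n)
      = qRacahEig q n (γ * δ) • trioVecV q N α β γ δ n := by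
  funext j
  rw [trioV]
  have := h.qRacahOp_apply (fun _ => 1) (fun i => qRacah q i n α β γ δ) j
  rw [show trioVecV q N α β γ δ n = fun i : Fin (N + 1) => qRacah q i n α β γ δ from rfl, this,
    Pi.smul_apply, smul_eq_mul, ← h.recurrence (by omega) hn]
  ring

/-- The diagonal conjugation that turns `Ṽ` into a standard `q`-Racah operator. -/
noncomputable def trioScale (q β δ α s : ℂ) (i : ℕ) : ℂ :=
  (β * δ * s) ^ i * qPochs q [q / s, q * α / δ] i / qPochs q [β * δ * q, α * β * s * q] i

theorem TrioGeneric.trioNu_factors (h : TrioGeneric q N α β γ δ s) {i : ℕ} (h0 : 0 < i)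
    (hi : i ≤ N) : s - q ^ i ≠ 0 ∧ δ - α * q ^ i ≠ 0 ∧ 1 - β * δ * q ^ i ≠ 0
      ∧ 1 - α * β * s * q ^ i ≠ 0 := by
  have hi : i ∈ Finset.Icc 1 N := by simp; omega
  refine ⟨fun e => h.mid.αδ_pow i hi ?_, fun e => h.fst.αδ_pow i hi ?_,
    fun e => h.fst.βδ_pow i hi ?_, fun e => h.mid.βδ_pow i hi ?_⟩
  · linear_combination (-α) * e
  · linear_combination -e
  · linear_combination -e
  · linear_combination -e

theorem TrioGeneric.trioNu_ne_zero (h : TrioGeneric q N α β γ δ s) {i : ℕ} (h0 : 0 < i)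
    (hi : i ≤ N) : trioNu q α β δ s i ≠ 0 := by
  obtain ⟨h1, h2, h3, h4⟩ := h.trioNu_factors h0 hi
  exact div_ne_zero (mul_ne_zero (mul_ne_zero h.fst.β_ne h1) h2) (mul_ne_zero h3 h4)

theorem TrioGeneric.trioScale_succ (h : TrioGeneric q N α β γ δ s) (i : ℕ) :
    trioScale q β δ α s (i + 1) = trioNu q α β δ s (i + 1) * trioScale q β δ α s i := by
  have hs := h.s_ne
  have hδ := h.fst.δ_ne
  simp only [trioScale, trioNu, qPochs, List.map_cons, List.map_nil, List.prod_cons,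
    List.prod_nil, qPoch_succ]
  rw [show 1 - q ^ i * (q / s) = (s - q ^ (i + 1)) / s by field_simp; ring,
    show 1 - q ^ i * (q * α / δ) = (δ - α * q ^ (i + 1)) / δ by field_simp; ring,
    show 1 - q ^ i * (β * δ * q) = 1 - β * δ * q ^ (i + 1) by ring,
    show 1 - q ^ i * (α * β * s * q) = 1 - α * β * s * q ^ (i + 1) by ring, pow_succ _ i]
  simp only [div_eq_mul_inv, mul_inv]
  linear_combination ((β * δ * s) ^ i * β * (qPoch q (q * s⁻¹) i * (s - q ^ i * q)
    * (qPoch q (q * α * δ⁻¹) i * (δ - α * (q ^ i * q)))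
    * ((qPoch q (β * δ * q) i)⁻¹ * (1 - β * δ * (q ^ i * q))⁻¹
    * ((qPoch q (α * β * s * q) i)⁻¹ * (1 - α * β * s * (q ^ i * q))⁻¹))))
    * (mul_inv_cancel₀ hs * (δ * δ⁻¹) + mul_inv_cancel₀ hδ)

theorem trioScale_zero : trioScale q β δ α s 0 = 1 := by simp [trioScale, qPochs]

theorem TrioGeneric.trioScale_ne_zero (h : TrioGeneric q N α β γ δ s) {i : ℕ} (hi : i ≤ N) :
    trioScale q β δ α s i ≠ 0 := by
  induction i with
  | zero => rw [trioScale_zero]; exact one_ne_zero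
  | succ i ih =>
    rw [h.trioScale_succ]
    exact mul_ne_zero (h.trioNu_ne_zero i.succ_pos hi) (ih (by omega))

/-- The recurrence relation with fourth parameter `α/(βδ)`, conjugated by `trioScale`, read as the
eigenvalue equation of `Ṽ`. -/
theorem TrioGeneric.trioVt_apply (h : TrioGeneric q N α β γ δ s) {x : ℕ} (hx : x ≤ N) :
    trioVt q N α β γ δ s (trioVecVt q N α β γ δ s x)
      = qRacahEig q x (γ * (α / (β * δ))) • trioVecVt q N α β γ δ s x := by
  funext j
  rw [trioVt]
  have := h.snd.qRacahOp_apply (trioNu q α β δ s)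
    (fun i => trioScale q β δ α s i * qRacah q i x α β γ (α / (β * δ))) j
  rw [show trioVecVt q N α β γ δ s x = fun i : Fin (N + 1) => trioScale q β δ α s i
    * qRacah q i x α β γ (α / (β * δ)) from rfl, this, Pi.smul_apply, smul_eq_mul]
  have hj : (j : ℕ) ≤ N := by omega
  generalize (j : ℕ) = j at *
  rw [mul_left_comm (qRacahEig q x _), ← h.snd.recurrence hj hx]
  have e1 : qRacahA q j α β γ (α / (β * δ)) * (1 / trioNu q α β δ s (j + 1))
      * (trioScale q β δ α s (j + 1) * qRacah q (j + 1) x α β γ (α / (β * δ)))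
      = trioScale q β δ α s j
        * (qRacahA q j α β γ (α / (β * δ)) * qRacah q (j + 1) x α β γ (α / (β * δ))) := by
    rcases hj.eq_or_lt with rfl | hj
    · rw [h.snd.qRacahA_self]; ring
    · have := h.trioNu_ne_zero j.succ_pos hj
      rw [h.trioScale_succ]
      field_simp
  have e2 : qRacahC q j α β γ (α / (β * δ)) * trioNu q α β δ s j
      * (trioScale q β δ α s (j - 1) * qRacah q (j - 1) x α β γ (α / (β * δ)))
      = trioScale q β δ α s j
        * (qRacahC q j α β γ (α / (β * δ)) * qRacah q (j - 1) x α β γ (α / (β * δ))) := by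
    rcases j with _ | j
    · rw [qRacahC_zero]; ring
    · rw [h.trioScale_succ, Nat.add_sub_cancel]; ring
  rw [e1, e2]
  ring

theorem trioZ_apply (f : Fin (N + 1) → ℂ) (i : Fin (N + 1)) :
    trioZ q N α β s f i = (qRacahEig q i (α * β) + (-1 / s - q * s * α * β)) * f i := by
  rw [trioZ, Matrix.toLin'_apply, Matrix.mulVec_diagonal]

/-- Raising coefficients of `Ṽ` in terms of those of `V`. -/
theorem TrioGeneric.raise (h : TrioGeneric q N α β γ δ s) {j : ℕ} (h0 : 0 < j) (hj : j ≤ N) :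
    qRacahC q j α β γ (α / (β * δ)) * trioNu q α β δ s j
      = qRacahC q j α β γ δ * (α * (s - q ^ j) / (δ * (1 - α * β * s * q ^ j))) := by
  obtain ⟨h1, h2, h3, h4⟩ := h.trioNu_factors h0 hj
  have hβ := h.fst.β_ne
  have hδ := h.fst.δ_ne
  rw [qRacahC, qRacahC, trioNu,
    show α / (β * δ) - α * q ^ j = α * (1 - β * δ * q ^ j) / (β * δ) by field_simp]
  generalize 1 - β * δ * q ^ j = d3 at *
  generalize 1 - α * β * s * q ^ j = d4 at *
  generalize (1 - α * β * q ^ (2 * j)) * (1 - α * β * q ^ (2 * j + 1)) = d5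
  simp only [div_eq_mul_inv, mul_inv]
  linear_combination (q * (1 - q ^ j) * (1 - β * q ^ j) * (γ - α * β * q ^ j) * d5⁻¹ * α
    * (s - q ^ j) * (δ - α * q ^ j) * d4⁻¹ * δ⁻¹)
    * (mul_inv_cancel₀ h3 * (β * β⁻¹) + mul_inv_cancel₀ hβ)

/-- Lowering coefficients of `Ṽ` in terms of those of `V`. -/
theorem TrioGeneric.lower (h : TrioGeneric q N α β γ δ s) {j : ℕ} (hj : j < N) :
    qRacahA q j α β γ (α / (β * δ)) * (1 / trioNu q α β δ s (j + 1))
      = qRacahA q j α β γ δ * ((1 - α * β * s * q ^ (j + 1)) / (β * δ * (s - q ^ (j + 1)))) := by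
  obtain ⟨h1, h2, h3, h4⟩ := h.trioNu_factors j.succ_pos hj
  have hβ := h.fst.β_ne
  have hδ := h.fst.δ_ne
  rw [qRacahA, qRacahA, trioNu,
    show 1 - β * (α / (β * δ)) * q ^ (j + 1) = (δ - α * q ^ (j + 1)) / δ by field_simp]
  generalize 1 - β * δ * q ^ (j + 1) = d3 at *
  generalize 1 - α * β * s * q ^ (j + 1) = d4 at *
  generalize s - q ^ (j + 1) = d1 at *
  generalize δ - α * q ^ (j + 1) = d2 at *
  generalize (1 - α * β * q ^ (2 * j + 1)) * (1 - α * β * q ^ (2 * j + 2)) = d5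
  field_simp

/-- The key relation between the diagonal coefficients of the two families: although `B_i` and
`B̃_i` are rational functions of `q^i`, this combination of them is constant. -/
theorem RacahGeneric.qRacahB_relation (h : RacahGeneric q N α β γ δ) {δ' : ℂ}
    (h' : RacahGeneric q N α β γ δ') (hδ : β * δ * δ' = α) {n : ℕ} (hn : n ≤ N) :
    (1 + q) * β * δ * qRacahB q n α β γ δ' + qRacahEig q n (α * β) * qRacahB q n α β γ δ
      = q * (α + α * β + β * δ + γ + γ * δ + β * γ * δ + α * β * δ + γ * α) := by
  have hq0 := h.q_ne
  have v : 1 - α * β * q ^ (2 * n + 1) ≠ 0 :=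
    sub_ne_zero.2 (h.αβ_pow _ (by simp; omega)).symm
  -- the factors `1 - αβ q^{2n+2}` and `1 - αβ q^{2n}` cancel in the two combinations below
  have eA : (1 + q) * β * δ * qRacahA q n α β γ δ' + qRacahEig q n (α * β) * qRacahA q n α β γ δ
      = (1 - α * q ^ (n + 1)) * (1 - α * β * q ^ (n + 1)) * (1 - γ * q ^ (n + 1))
        * (β * δ + (q ^ n)⁻¹) / (1 - α * β * q ^ (2 * n + 1)) := by
    rcases hn.eq_or_lt with rfl | hn
    · rw [h.qRacahA_self, h'.qRacahA_self]
      rcases h.cut with h | h <;> simp [h]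
    have w : 1 - α * β * q ^ (2 * n + 2) ≠ 0 :=
      sub_ne_zero.2 (h.αβ_pow _ (by simp; omega)).symm
    rw [qRacahA, qRacahA, qRacahEig, zpow_neg, zpow_natCast]
    generalize h5 : 1 - α * β * q ^ (2 * n + 1) = d5 at *
    generalize h6 : 1 - α * β * q ^ (2 * n + 2) = d6 at *
    field_simp
    subst h5 h6
    linear_combination (-(1 - α * q ^ (n + 1)) * (1 - γ * q ^ (n + 1))
      * (1 - α * β * q ^ (n + 1)) * q ^ n * β * q ^ (n + 1) * (1 + q)) * hδ
  have eC : (1 + q) * β * δ * qRacahC q n α β γ δ' + qRacahEig q n (α * β) * qRacahC q n α β γ δ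
      = q * (1 - q ^ n) * (1 - β * q ^ n) * (γ - α * β * q ^ n) * (δ * (q ^ n)⁻¹ + q * α)
        / (1 - α * β * q ^ (2 * n + 1)) := by
    rcases n with _ | n
    · simp [qRacahC_zero]
    have u : 1 - α * β * q ^ (2 * (n + 1)) ≠ 0 :=
      sub_ne_zero.2 (h.αβ_pow _ (by simp; omega)).symm
    rw [qRacahC, qRacahC, qRacahEig, zpow_neg, zpow_natCast]
    generalize h5 : 1 - α * β * q ^ (2 * (n + 1) + 1) = d5 at *
    generalize h6 : 1 - α * β * q ^ (2 * (n + 1)) = d6 at *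
    field_simp
    subst h5 h6
    linear_combination ((1 - q ^ (n + 1)) * (1 - β * q ^ (n + 1)) * (γ - α * β * q ^ (n + 1))
      * q ^ (n + 1) * (1 + q)) * hδ
  rw [qRacahB, qRacahB]
  have e : (1 + q) * β * δ * (1 + γ * δ' * q) + qRacahEig q n (α * β) * (1 + γ * δ * q)
      - (1 - α * q ^ (n + 1)) * (1 - α * β * q ^ (n + 1)) * (1 - γ * q ^ (n + 1))
        * (β * δ + (q ^ n)⁻¹) / (1 - α * β * q ^ (2 * n + 1))
      - q * (1 - q ^ n) * (1 - β * q ^ n) * (γ - α * β * q ^ n) * (δ * (q ^ n)⁻¹ + q * α)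
        / (1 - α * β * q ^ (2 * n + 1))
      = q * (α + α * β + β * δ + γ + γ * δ + β * γ * δ + α * β * δ + γ * α) := by
    rw [qRacahEig, zpow_neg, zpow_natCast]
    generalize h5 : 1 - α * β * q ^ (2 * n + 1) = d5 at *
    field_simp
    subst h5
    linear_combination ((1 + q) * γ * q * q ^ n * (1 - α * β * q ^ (2 * n + 1))) * hδ
  linear_combination e - eA - eC

end Operators

/-! ### Relations between the three operators -/

section Relations

variable {q : ℂ} {N : ℕ} {α β γ δ s : ℂ}

/-- Vectors are extended to functions on `ℕ`, so that neighbouring indices can be written as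
`i ± 1`. -/
theorem exists_eq_comp_val {d : ℕ} (f : Fin d → ℂ) : ∃ F : ℕ → ℂ, f = fun i : Fin d => F i :=
  ⟨fun i => if hi : i < d then f ⟨i, hi⟩ else 0, funext fun i => by
    beta_reduce; rw [dif_pos i.isLt]⟩

/-- The operator relation that makes `ṼZ` tridiagonal in every basis in which `V` is diagonal and
`Z` is tridiagonal. -/
theorem TrioGeneric.Vt_mul_Z (h : TrioGeneric q N α β γ δ s) :
    ∃ a b c e : ℂ, trioVt q N α β γ δ s * trioZ q N α β s
      = a • (trioV q N α β γ δ * trioZ q N α β s) + b • (trioZ q N α β s * trioV q N α β γ δ)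
        + c • trioV q N α β γ δ + e • 1 := by
  have hq0 := h.fst.q_ne
  have hβ := h.fst.β_ne
  have hδ := h.fst.δ_ne
  have hs := h.s_ne
  have hq2 : q ^ 2 - 1 ≠ 0 := sub_ne_zero.2 (h.fst.q_pow 2 (by norm_num))
  -- the off-diagonal entries require `a + b / q = α s / δ` and `a + b q = 1 / (β δ s)`
  obtain ⟨b, hb⟩ : ∃ b : ℂ, b = (1 / (β * δ * s) - α * s / δ) * q / (q ^ 2 - 1) := ⟨_, rfl⟩
  obtain ⟨a, ha⟩ : ∃ a : ℂ, a = α * s / δ - b / q := ⟨_, rfl⟩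
  have hb' : a + b * q = 1 / (β * δ * s) := by
    rw [ha, hb]; field_simp; ring
  have hab : (a + b) * (1 + q) = q * α * s / δ + 1 / (β * δ * s) := by
    rw [← hb', ha]; field_simp; ring
  have B1 := fun {n : ℕ} (hn : n ≤ N) => h.fst.qRacahB_relation h.snd
    (show β * δ * (α / (β * δ)) = α by field_simp) hn
  have B2 := fun {n : ℕ} (hn : n ≤ N) => h.snd.qRacahB_relation h.fst
    (show β * (α / (β * δ)) * δ = α by field_simp) hn
  refine ⟨a, b, -(α / δ) * (1 + q) - (a + b) * (-1 / s - q * s * α * β),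
    q * (α + α * β + β * (α / (β * δ)) + γ + γ * (α / (β * δ)) + β * γ * (α / (β * δ))
      + α * β * (α / (β * δ)) + γ * α)
    - (a + b) * (q * (α + α * β + β * δ + γ + γ * δ + β * γ * δ + α * β * δ + γ * α)), ?_⟩
  refine LinearMap.ext fun f => funext fun j => ?_
  obtain ⟨F, rfl⟩ := exists_eq_comp_val f
  have eZ : trioZ q N α β s (fun i : Fin (N + 1) => F i) = fun i : Fin (N + 1) =>
      (qRacahEig q i (α * β) + (-1 / s - q * s * α * β)) * F i :=
    funext fun i => trioZ_apply _ i
  have hj : (j : ℕ) ≤ N := by omega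
  simp only [LinearMap.add_apply, LinearMap.smul_apply, Module.End.mul_apply,
    Module.End.one_apply, Pi.add_apply, Pi.smul_apply, smul_eq_mul]
  have o1 := h.snd.qRacahOp_apply (trioNu q α β δ s)
    (fun i => (qRacahEig q i (α * β) + (-1 / s - q * s * α * β)) * F i) j
  have o2 := h.fst.qRacahOp_apply (fun _ => 1)
    (fun i => (qRacahEig q i (α * β) + (-1 / s - q * s * α * β)) * F i) j
  have o3 := h.fst.qRacahOp_apply (fun _ => 1) F j
  beta_reduce at o1 o2
  rw [trioZ_apply, eZ, trioV, trioVt, o1, o2, o3]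
  clear o1 o2 o3 eZ
  generalize (j : ℕ) = j at *
  -- the superdiagonal, the diagonal and the subdiagonal
  have t1 : qRacahA q j α β γ (α / (β * δ)) * (1 / trioNu q α β δ s (j + 1))
        * (qRacahEig q (j + 1) (α * β) + (-1 / s - q * s * α * β))
      = qRacahA q j α β γ δ * (a * (qRacahEig q (j + 1) (α * β) + (-1 / s - q * s * α * β))
        + b * (qRacahEig q j (α * β) + (-1 / s - q * s * α * β))
        + (-(α / δ) * (1 + q) - (a + b) * (-1 / s - q * s * α * β))) := by
    rcases hj.eq_or_lt with rfl | hj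
    · rw [h.fst.qRacahA_self, h.snd.qRacahA_self]; ring
    rw [h.lower hj, mul_assoc]
    congr 1
    have n1 := (h.trioNu_factors j.succ_pos hj).1
    have e1 : qRacahEig q (j + 1) (α * β) + (-1 / s - q * s * α * β)
        = (s - q ^ (j + 1)) * ((1 - α * β * s * q ^ (j + 2)) / (s * q ^ (j + 1))) := by
      rw [qRacahEig, zpow_neg, zpow_natCast]; field_simp; ring
    have e2 : (1 - α * β * s * q ^ (j + 1)) / (β * δ * (s - q ^ (j + 1)))
        * ((s - q ^ (j + 1)) * ((1 - α * β * s * q ^ (j + 2)) / (s * q ^ (j + 1))))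
        = (1 - α * β * s * q ^ (j + 1)) * (1 - α * β * s * q ^ (j + 2))
          / (β * δ * s * q ^ (j + 1)) := by
      generalize s - q ^ (j + 1) = d1 at *
      field_simp
    have e3 : (1 - α * β * s * q ^ (j + 1)) * (1 - α * β * s * q ^ (j + 2))
          / (β * δ * s * q ^ (j + 1)) = (1 / (β * δ * s)) / q ^ (j + 1)
          + (α * s / δ) * (α * β * q ^ (j + 2)) - (α / δ) * (1 + q) := by
      field_simp; ring
    have e4 : α * s / δ = a + b / q := by rw [ha]; ring
    rw [e1, e2, e3, ← e1, ← hb', e4, qRacahEig, qRacahEig, zpow_neg, zpow_natCast, zpow_neg,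
      zpow_natCast]
    field_simp
    ring
  have t2 : qRacahC q j α β γ (α / (β * δ)) * trioNu q α β δ s j
        * (qRacahEig q (j - 1) (α * β) + (-1 / s - q * s * α * β))
      = qRacahC q j α β γ δ * (a * (qRacahEig q (j - 1) (α * β) + (-1 / s - q * s * α * β))
        + b * (qRacahEig q j (α * β) + (-1 / s - q * s * α * β))
        + (-(α / δ) * (1 + q) - (a + b) * (-1 / s - q * s * α * β))) := by
    rcases j with _ | j
    · rw [qRacahC_zero, qRacahC_zero]; ring
    rw [h.raise j.succ_pos hj, mul_assoc, Nat.add_sub_cancel]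
    congr 1
    have n1 := (h.trioNu_factors j.succ_pos hj).2.2.2
    have e1 : qRacahEig q j (α * β) + (-1 / s - q * s * α * β)
        = (1 - α * β * s * q ^ (j + 1)) * ((s - q ^ j) / (s * q ^ j)) := by
      rw [qRacahEig, zpow_neg, zpow_natCast]; field_simp; ring
    have e2 : α * (s - q ^ (j + 1)) / (δ * (1 - α * β * s * q ^ (j + 1)))
        * ((1 - α * β * s * q ^ (j + 1)) * ((s - q ^ j) / (s * q ^ j)))
        = α * (s - q ^ (j + 1)) * (s - q ^ j) / (δ * s * q ^ j) := by
      generalize 1 - α * β * s * q ^ (j + 1) = d1 at *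
      field_simp
    have e3 : α * (s - q ^ (j + 1)) * (s - q ^ j) / (δ * s * q ^ j)
        = (α * s / δ) / q ^ j + (1 / (β * δ * s)) * (α * β * q ^ (j + 1))
          - (α / δ) * (1 + q) := by
      field_simp; ring
    have e4 : α * s / δ = a + b / q := by rw [ha]; ring
    rw [e1, e2, e3, ← e1, ← hb', e4, qRacahEig, qRacahEig, zpow_neg, zpow_natCast, zpow_neg,
      zpow_natCast]
    field_simp
    ring
  have t3 : qRacahB q j α β γ (α / (β * δ))
        * (qRacahEig q j (α * β) + (-1 / s - q * s * α * β))
      = qRacahB q j α β γ δ * ((a + b) * (qRacahEig q j (α * β) + (-1 / s - q * s * α * β))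
        + (-(α / δ) * (1 + q) - (a + b) * (-1 / s - q * s * α * β)))
        + (q * (α + α * β + β * (α / (β * δ)) + γ + γ * (α / (β * δ)) + β * γ * (α / (β * δ))
          + α * β * (α / (β * δ)) + γ * α)
        - (a + b) * (q * (α + α * β + β * δ + γ + γ * δ + β * γ * δ + α * β * δ + γ * α))) := by
    rw [← B1 hj, ← B2 hj]
    have e5 : (1 + q) * β * (α / (β * δ)) = (1 + q) * (α / δ) := by field_simp
    have e6 : (a + b) * ((1 + q) * β * δ) = -(-1 / s - q * s * α * β) := by
      rw [show (a + b) * ((1 + q) * β * δ) = (a + b) * (1 + q) * (β * δ) by ring, hab]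
      field_simp; ring
    rw [e5]
    linear_combination qRacahB q j α β γ (α / (β * δ)) * e6
  linear_combination F (j + 1) * t1 + F (j - 1) * t2 + F j * t3

/-- The operator relation that makes `ZV` tridiagonal in every basis in which `Ṽ` is diagonal and
`Z` is tridiagonal. -/
theorem TrioGeneric.Z_mul_V (h : TrioGeneric q N α β γ δ s) :
    ∃ a b c e : ℂ, trioZ q N α β s * trioV q N α β γ δ
      = a • (trioVt q N α β γ δ s * trioZ q N α β s)
        + b • (trioZ q N α β s * trioVt q N α β γ δ s)
        + c • trioVt q N α β γ δ s + e • 1 := by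
  have hq0 := h.fst.q_ne
  have hα := h.fst.α_ne
  have hβ := h.fst.β_ne
  have hδ := h.fst.δ_ne
  have hs := h.s_ne
  have hq2 : q ^ 2 - 1 ≠ 0 := sub_ne_zero.2 (h.fst.q_pow 2 (by norm_num))
  -- the off-diagonal entries require `b + a / q = β δ s` and `b + a q = δ / (α s)`
  obtain ⟨a, ha⟩ : ∃ a : ℂ, a = (δ / (α * s) - β * δ * s) * q / (q ^ 2 - 1) := ⟨_, rfl⟩
  obtain ⟨b, hb⟩ : ∃ b : ℂ, b = β * δ * s - a / q := ⟨_, rfl⟩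
  have hb' : b + a * q = δ / (α * s) := by
    rw [hb, ha]; field_simp; ring
  have hab : (a + b) * (1 + q) = q * (β * δ * s) + δ / (α * s) := by
    rw [← hb', hb]; field_simp; ring
  have B1 := fun {n : ℕ} (hn : n ≤ N) => h.fst.qRacahB_relation h.snd
    (show β * δ * (α / (β * δ)) = α by field_simp) hn
  have B2 := fun {n : ℕ} (hn : n ≤ N) => h.snd.qRacahB_relation h.fst
    (show β * (α / (β * δ)) * δ = α by field_simp) hn
  refine ⟨a, b, -(β * δ) * (1 + q) - (a + b) * (-1 / s - q * s * α * β),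
    q * (α + α * β + β * δ + γ + γ * δ + β * γ * δ + α * β * δ + γ * α)
    - (a + b) * (q * (α + α * β + β * (α / (β * δ)) + γ + γ * (α / (β * δ))
      + β * γ * (α / (β * δ)) + α * β * (α / (β * δ)) + γ * α)), ?_⟩
  refine LinearMap.ext fun f => funext fun j => ?_
  obtain ⟨F, rfl⟩ := exists_eq_comp_val f
  have eZ : trioZ q N α β s (fun i : Fin (N + 1) => F i) = fun i : Fin (N + 1) =>
      (qRacahEig q i (α * β) + (-1 / s - q * s * α * β)) * F i :=
    funext fun i => trioZ_apply _ i
  have hj : (j : ℕ) ≤ N := by omega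
  simp only [LinearMap.add_apply, LinearMap.smul_apply, Module.End.mul_apply,
    Module.End.one_apply, Pi.add_apply, Pi.smul_apply, smul_eq_mul]
  have o1 := h.snd.qRacahOp_apply (trioNu q α β δ s)
    (fun i => (qRacahEig q i (α * β) + (-1 / s - q * s * α * β)) * F i) j
  have o2 := h.snd.qRacahOp_apply (trioNu q α β δ s) F j
  have o3 := h.fst.qRacahOp_apply (fun _ => 1) F j
  beta_reduce at o1
  rw [trioZ_apply, trioZ_apply, eZ, trioV, trioVt, o1, o2, o3]
  clear o1 o2 o3 eZ
  generalize (j : ℕ) = j at *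
  -- the superdiagonal, the diagonal and the subdiagonal
  have t1 : (qRacahEig q j (α * β) + (-1 / s - q * s * α * β)) * qRacahA q j α β γ δ
      = qRacahA q j α β γ (α / (β * δ)) * (1 / trioNu q α β δ s (j + 1))
        * (a * (qRacahEig q (j + 1) (α * β) + (-1 / s - q * s * α * β))
        + b * (qRacahEig q j (α * β) + (-1 / s - q * s * α * β))
        + (-(β * δ) * (1 + q) - (a + b) * (-1 / s - q * s * α * β))) := by
    rcases hj.eq_or_lt with rfl | hj
    · rw [h.fst.qRacahA_self, h.snd.qRacahA_self]; ring
    rw [h.lower hj, mul_comm (_ + _) (qRacahA q j α β γ δ), mul_assoc (qRacahA q j α β γ δ)]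
    congr 1
    have n1 := (h.trioNu_factors j.succ_pos hj).1
    have e1 : qRacahEig q j (α * β) + (-1 / s - q * s * α * β)
        = (1 - α * β * s * q ^ (j + 1)) * ((s - q ^ j) / (s * q ^ j)) := by
      rw [qRacahEig, zpow_neg, zpow_natCast]; field_simp; ring
    have e3 : a * (qRacahEig q (j + 1) (α * β) + (-1 / s - q * s * α * β))
        + b * (qRacahEig q j (α * β) + (-1 / s - q * s * α * β))
        + (-(β * δ) * (1 + q) - (a + b) * (-1 / s - q * s * α * β))
        = (b + a / q) / q ^ j + (b + a * q) * (α * β * q ^ (j + 1)) - β * δ * (1 + q) := by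
      rw [qRacahEig, qRacahEig, zpow_neg, zpow_natCast, zpow_neg, zpow_natCast]
      field_simp
      ring
    have e4 : b + a / q = β * δ * s := by rw [hb]; ring
    have e5 : β * δ * s / q ^ j + δ / (α * s) * (α * β * q ^ (j + 1)) - β * δ * (1 + q)
        = (s - q ^ (j + 1)) * (β * δ * (s - q ^ j) / (s * q ^ j)) := by
      field_simp; ring
    rw [e3, e4, hb', e5, e1]
    generalize s - q ^ (j + 1) = d1 at *
    field_simp
  have t2 : (qRacahEig q j (α * β) + (-1 / s - q * s * α * β)) * qRacahC q j α β γ δ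
      = qRacahC q j α β γ (α / (β * δ)) * trioNu q α β δ s j
        * (a * (qRacahEig q (j - 1) (α * β) + (-1 / s - q * s * α * β))
        + b * (qRacahEig q j (α * β) + (-1 / s - q * s * α * β))
        + (-(β * δ) * (1 + q) - (a + b) * (-1 / s - q * s * α * β))) := by
    rcases j with _ | j
    · rw [qRacahC_zero, qRacahC_zero]; ring
    rw [h.raise j.succ_pos hj, mul_comm (_ + _) (qRacahC q (j + 1) α β γ δ),
      mul_assoc (qRacahC q (j + 1) α β γ δ), Nat.add_sub_cancel]
    congr 1
    have n1 := (h.trioNu_factors j.succ_pos hj).2.2.2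
    have e1 : qRacahEig q (j + 1) (α * β) + (-1 / s - q * s * α * β)
        = (s - q ^ (j + 1)) * ((1 - α * β * s * q ^ (j + 2)) / (s * q ^ (j + 1))) := by
      rw [qRacahEig, zpow_neg, zpow_natCast]; field_simp; ring
    have e3 : a * (qRacahEig q j (α * β) + (-1 / s - q * s * α * β))
        + b * (qRacahEig q (j + 1) (α * β) + (-1 / s - q * s * α * β))
        + (-(β * δ) * (1 + q) - (a + b) * (-1 / s - q * s * α * β))
        = (b + a * q) / q ^ (j + 1) + (b + a / q) * (α * β * q ^ (j + 2))
          - β * δ * (1 + q) := by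
      rw [qRacahEig, qRacahEig, zpow_neg, zpow_natCast, zpow_neg, zpow_natCast]
      field_simp
      ring
    have e4 : b + a / q = β * δ * s := by rw [hb]; ring
    have e5 : δ / (α * s) / q ^ (j + 1) + β * δ * s * (α * β * q ^ (j + 2)) - β * δ * (1 + q)
        = (1 - α * β * s * q ^ (j + 1))
          * (δ * (1 - α * β * s * q ^ (j + 2)) / (α * s * q ^ (j + 1))) := by
      field_simp; ring
    rw [e3, e4, hb', e5, e1]
    generalize 1 - α * β * s * q ^ (j + 1) = d1 at *
    field_simp
  have t3 : (qRacahEig q j (α * β) + (-1 / s - q * s * α * β)) * qRacahB q j α β γ δ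
      = qRacahB q j α β γ (α / (β * δ))
        * ((a + b) * (qRacahEig q j (α * β) + (-1 / s - q * s * α * β))
        + (-(β * δ) * (1 + q) - (a + b) * (-1 / s - q * s * α * β)))
        + (q * (α + α * β + β * δ + γ + γ * δ + β * γ * δ + α * β * δ + γ * α)
        - (a + b) * (q * (α + α * β + β * (α / (β * δ)) + γ + γ * (α / (β * δ))
          + β * γ * (α / (β * δ)) + α * β * (α / (β * δ)) + γ * α))) := by
    rw [← B1 hj, ← B2 hj]
    have e5 : (1 + q) * β * (α / (β * δ)) = (1 + q) * (α / δ) := by field_simp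
    have e6 : (a + b) * ((1 + q) * (α / δ)) = -(-1 / s - q * s * α * β) := by
      rw [← mul_assoc, hab]
      field_simp; ring
    rw [e5]
    linear_combination qRacahB q j α β γ δ * e6
  linear_combination F (j + 1) * t1 + F (j - 1) * t2 + F j * t3

end Relations

/-! ### Eigenbases and tridiagonal matrices -/

section Bases

variable {q : ℂ} {N : ℕ} {α β γ δ : ℂ}

/-- If `X` is a combination of `VZ`, `ZV`, `V` and the identity, with `V` diagonal and `Z`
tridiagonal, then `X` is tridiagonal. -/
theorem IsTridiagonal.of_relation {d : ℕ} {E : Type*} [AddCommGroup E] [Module ℂ E]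
    (v : Basis (Fin d) ℂ E) {X V Z : Module.End ℂ E} (hV : (LinearMap.toMatrix v v V).IsDiag)
    (hZ : IsTridiagonal (LinearMap.toMatrix v v Z)) {a b c e : ℂ}
    (hX : X = a • (V * Z) + b • (Z * V) + c • V + e • 1) :
    IsTridiagonal (LinearMap.toMatrix v v X) := by
  intro i j hij
  have hne : i ≠ j := fun h => by rw [h] at hij; omega
  rw [hX, map_add, map_add, map_add, map_smul, map_smul, map_smul, map_smul,
    LinearMap.toMatrix_mul, LinearMap.toMatrix_mul, LinearMap.toMatrix_one, ← hV.diagonal_diag]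
  simp [Matrix.diagonal_mul, Matrix.mul_diagonal, hZ i j hij, hne]

/-- The difference equation, as a statement on the matrix of `Z` in a basis of rescaled
`q`-Racah polynomials. -/
theorem RacahGeneric.isIrredTridiagonal_Z (h : RacahGeneric q N α β γ δ) (s : ℂ) (d : ℕ → ℂ)
    (v : Basis (Fin (N + 1)) ℂ (Fin (N + 1) → ℂ))
    (hv : ∀ n, v n = fun i : Fin (N + 1) => d i * qRacah q i n α β γ δ) :
    IsIrredTridiagonal (LinearMap.toMatrix v v (trioZ q N α β s)) := by
  set T : Fin (N + 1) → Fin (N + 1) → ℂ := fun j i =>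
    if (i : ℕ) = j + 1 then qRacahA q j γ δ α β
    else if (i : ℕ) = j then qRacahB q j γ δ α β + (-1 / s - q * s * α * β)
    else if (i : ℕ) + 1 = j then qRacahC q j γ δ α β else 0 with hT
  have hZ : ∀ j, trioZ q N α β s (v j) = ∑ i, T j i • v i := by
    intro j
    funext k
    have hk : (k : ℕ) ≤ N := by omega
    have hj : (j : ℕ) ≤ N := by omega
    have key := sum_tridiagonal (T j) (fun i => d k * qRacah q k i α β γ δ) hj
      (a := qRacahA q j γ δ α β) (b := qRacahB q j γ δ α β + (-1 / s - q * s * α * β))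
      (c := qRacahC q j γ δ α β) (fun i hi => by simp [hT, hi])
      (fun e => by rw [e, h.symm.qRacahA_self])
      (fun i hi => by simp [hT, hi])
      (fun i hi => by
        simp only [hT]
        rw [if_neg (by omega), if_neg (by omega), if_pos hi])
      (fun e => by rw [e, qRacahC_zero])
      (fun i hi => by
        simp only [hT]
        rw [if_neg (by omega), if_neg (by omega), if_neg (by omega)])
    simp only [Finset.sum_apply, Pi.smul_apply, smul_eq_mul, hv]
    rw [key, trioZ_apply]
    linear_combination (-d k) * h.difference hk hj
  have hM : ∀ i j, LinearMap.toMatrix v v (trioZ q N α β s) i j = T j i := by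
    intro i j
    rw [LinearMap.toMatrix_apply, hZ, Basis.repr_sum_self]
  refine ⟨fun i j hij => ?_, fun i j hij => ?_⟩
  · rw [hM]
    simp only [hT]
    rw [if_neg (by omega), if_neg (by omega), if_neg (by omega)]
  · rw [hM]
    simp only [hT]
    rcases hij with hij | hij
    · rw [if_neg (by omega), if_neg (by omega), if_pos hij]
      exact h.symm.qRacahC_ne_zero (by omega) (by omega)
    · rw [if_pos hij.symm]
      exact h.symm.qRacahA_ne_zero (by omega)

theorem RacahGeneric.isIrredTridiagonal_qRacahOp (h : RacahGeneric q N α β γ δ) {ν : ℕ → ℂ}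
    (hν : ∀ i, 0 < i → i ≤ N → ν i ≠ 0) :
    IsIrredTridiagonal (LinearMap.toMatrix (Pi.basisFun ℂ (Fin (N + 1)))
      (Pi.basisFun ℂ (Fin (N + 1))) (qRacahOp q N α β γ δ ν)) := by
  rw [LinearMap.toMatrix_eq_toMatrix', qRacahOp, LinearMap.toMatrix'_toLin']
  refine ⟨fun i j hij => ?_, fun i j hij => ?_⟩
  · rw [Matrix.of_apply, if_neg (by omega), if_neg (by intro e; rw [e] at hij; omega),
      if_neg (by omega)]
  · rw [Matrix.of_apply]
    rcases hij with hij | hij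
    · rw [if_neg (by omega), if_neg (by intro e; rw [e] at hij; omega), if_pos hij]
      exact mul_ne_zero (h.qRacahA_ne_zero (by omega))
        (one_div_ne_zero (hν _ (by omega) (by omega)))
    · rw [if_pos hij.symm]
      exact mul_ne_zero (h.qRacahC_ne_zero (by omega) (by omega)) (hν _ (by omega) (by omega))

/-- Eigenvectors for the `N + 1` distinct eigenvalues `λ(n; γδ)` form a basis. -/
theorem RacahGeneric.exists_basis (h : RacahGeneric q N α β γ δ)
    (f : Module.End ℂ (Fin (N + 1) → ℂ)) (w : ℕ → Fin (N + 1) → ℂ)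
    (hw : ∀ n ≤ N, f (w n) = qRacahEig q n (γ * δ) • w n) (hw0 : ∀ n, w n 0 = 1) :
    ∃ v : Basis (Fin (N + 1)) ℂ (Fin (N + 1) → ℂ), ∀ n, v n = w n := by
  have hli : LinearIndependent ℂ fun n : Fin (N + 1) => w n := by
    refine Module.End.eigenvectors_linearIndependent' f
      (fun n : Fin (N + 1) => qRacahEig q n (γ * δ)) ?_ _ fun n => ?_
    · intro m n hmn
      by_contra hne
      exact h.qRacahEig_injective (by omega) (by omega) (fun e => hne (Fin.ext e)) hmn
    · refine Module.End.hasEigenvector_iff.2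
        ⟨Module.End.mem_eigenspace_iff.2 (hw n (by omega)), fun e => ?_⟩
      have := hw0 n
      rw [e] at this
      simp at this
  exact ⟨basisOfLinearIndependentOfCardEqFinrank hli (by simp), fun n => by simp⟩

theorem isDiag_toMatrix {d : ℕ} {E : Type*} [AddCommGroup E] [Module ℂ E]
    (v : Basis (Fin d) ℂ E) {f : Module.End ℂ E} {c : Fin d → ℂ} (h : ∀ j, f (v j) = c j • v j) :
    (LinearMap.toMatrix v v f).IsDiag := by
  intro i j hij
  rw [LinearMap.toMatrix_apply, h]
  simp [hij.symm]

end Bases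

/-! ### The Leonard trio -/

section Trio

variable {q : ℂ} {N : ℕ} {α β γ δ s : ℂ}

theorem TrioGeneric.isIrredLeonardTrio (h : TrioGeneric q N α β γ δ s)
    (v vt : Basis (Fin (N + 1)) ℂ (Fin (N + 1) → ℂ))
    (hv : ∀ n, v n = trioVecV q N α β γ δ n) (hvt : ∀ x, vt x = trioVecVt q N α β γ δ s x) :
    IsIrredLeonardTrio (trioV q N α β γ δ) (trioVt q N α β γ δ s) (trioZ q N α β s)
      v vt (Pi.basisFun ℂ (Fin (N + 1))) := by
  have d1 : (LinearMap.toMatrix v v (trioV q N α β γ δ)).IsDiag :=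
    isDiag_toMatrix v fun j => by rw [hv]; exact h.fst.trioV_apply (by omega)
  have d2 : (LinearMap.toMatrix vt vt (trioVt q N α β γ δ s)).IsDiag :=
    isDiag_toMatrix vt fun j => by rw [hvt]; exact h.trioVt_apply (by omega)
  have i1 := h.fst.isIrredTridiagonal_Z s (fun _ => 1) v fun n => by
    rw [hv]; funext i; simp [trioVecV]
  have i2 := h.snd.isIrredTridiagonal_Z s (trioScale q β δ α s) vt fun n => by
    rw [hvt]; rfl
  obtain ⟨_, _, _, _, r1⟩ := h.Vt_mul_Z
  obtain ⟨_, _, _, _, r2⟩ := h.Z_mul_V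
  refine ⟨d1, IsTridiagonal.of_relation v d1 i1.1 r1, i1, d2, ?_, i2, ?_,
    h.fst.isIrredTridiagonal_qRacahOp fun _ _ _ => one_ne_zero,
    h.snd.isIrredTridiagonal_qRacahOp fun i h0 hi => h.trioNu_ne_zero h0 hi⟩
  · exact IsTridiagonal.of_relation vt d2 i2.1 r2
  · rw [LinearMap.toMatrix_eq_toMatrix', trioZ, LinearMap.toMatrix'_toLin']
    exact Matrix.isDiag_diagonal _

end Trio

/-! ### Overlap coefficients and Wilson rational functions -/

section Wilson

variable {q : ℂ} {N : ℕ} {α β γ δ s : ℂ}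

theorem complex_sqrt_mul_self (a : ℂ) : a.sqrt * a.sqrt = a := by
  rw [← sq, Complex.sqrt]
  exact_mod_cast Complex.cpow_nat_inv_pow a (two_ne_zero)

/-- The four Pochhammer symbols containing `√a` combine to the very-well-poised factor. -/
theorem qPoch_veryWellPoised {a r : ℂ} (hr : r * r = a) {k : ℕ}
    (h : ∀ j < k + 1, a * q ^ (2 * j) ≠ 1) :
    qPoch q (q * r) k * qPoch q (-(q * r)) k / (qPoch q r k * qPoch q (-r) k)
      = (1 - a * q ^ (2 * k)) / (1 - a) := by
  have n1 : qPoch q r (k + 1) ≠ 0 := qPoch_ne_zero fun j hj e => h j hj (by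
    rw [← hr]; linear_combination (q ^ j * r + 1) * e)
  have n2 : qPoch q (-r) (k + 1) ≠ 0 := qPoch_ne_zero fun j hj e => h j hj (by
    rw [← hr]; linear_combination (-q ^ j * r + 1) * e)
  have n3 : 1 - r ≠ 0 := fun e => n1 (by rw [qPoch_succ', e, zero_mul])
  have n4 : 1 - -r ≠ 0 := fun e => n2 (by rw [qPoch_succ', e, zero_mul])
  have n5 : 1 - a ≠ 0 := by
    rw [← hr, show 1 - r * r = (1 - r) * (1 - -r) by ring]
    exact mul_ne_zero n3 n4
  have e1 : (1 - r) * qPoch q (q * r) k = qPoch q r k * (1 - q ^ k * r) := by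
    rw [← qPoch_succ', qPoch_succ]
  have e2 : (1 - -r) * qPoch q (-(q * r)) k = qPoch q (-r) k * (1 - q ^ k * -r) := by
    rw [← qPoch_succ, qPoch_succ', mul_neg]
  rw [qPoch_succ] at n1 n2
  rw [div_eq_div_iff (mul_ne_zero (left_ne_zero_of_mul n1) (left_ne_zero_of_mul n2)) n5]
  have e3 : 1 - a = (1 - r) * (1 - -r) := by rw [← hr]; ring
  have e4 : 1 - a * q ^ (2 * k) = (1 - q ^ k * r) * (1 - q ^ k * -r) := by rw [← hr]; ring
  rw [e3, e4]
  linear_combination ((1 - -r) * qPoch q (-(q * r)) k) * e1 + qPoch q r k * (1 - q ^ k * r) * e2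

/-- The products of connection coefficients, divided by the dual weight, are the terms of a
Wilson rational function. -/
theorem TrioGeneric.sum_connCoeff_eq_wilsonRat (h : TrioGeneric q N α β γ δ s) {n : ℕ}
    (hn : n ≤ N) (x : ℕ) :
    ∑ k ∈ Finset.range (N + 1), connCoeff q β γ (α / (β * δ)) (α * s) x k
        * connCoeff q β γ δ (α * s) n k / qRacahWeight q k γ (α * s) α β
      = wilsonRat q n x (α * γ * s * q) (γ * δ) (α * γ / (β * δ)) (1 / γ) (1 / α) (β / γ) := by
  have hq0 := h.fst.q_ne
  have hα := h.fst.α_ne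
  have hβ := h.fst.β_ne
  have hγ := h.fst.γ_ne
  have hδ := h.fst.δ_ne
  rw [wilsonRat, qHyp, ← Finset.sum_subset (Finset.range_subset_range.2 (Nat.succ_le_succ hn))]
  swap
  · intro k _ hk
    rw [connCoeff_eq_zero hq0 β γ δ (α * s) (show n < k by simpa using hk), mul_zero, zero_div]
  refine Finset.sum_congr rfl fun k hk => ?_
  have hk : k ≤ N := by simp at hk; omega
  have vwp := qPoch_veryWellPoised (complex_sqrt_mul_self (α * γ * s * q)) (q := q) (k := k)
    fun j hj e => h.mid.γδ_pow (2 * j + 1) (by simp; omega) (by rw [← e]; ring)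
  have hz : (1 / (β * (α / (β * δ)))) ^ k * (1 / (β * δ)) ^ k * (α * β * q) ^ k = q ^ k := by
    rw [← mul_pow, ← mul_pow]; congr 1; field_simp
  simp only [connCoeff, qRacahWeight, qPochs, List.map_cons, List.map_nil, List.prod_cons,
    List.prod_nil, List.cons_append, List.nil_append, mul_one]
  rw [show α * γ * s * q * (1 / γ) = α * s * q by field_simp,
    show α * γ * s * q * (1 / α) = γ * (α * s) * q / α by field_simp,
    show α * γ * s * q * (β / γ) = β * (α * s) * q by field_simp,
    show α * γ * s * q * q ^ (-(n : ℤ)) / (γ * δ) = α * s * q * q ^ (-(n : ℤ)) / δ by field_simp,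
    show α * γ * s * q * q ^ (n + 1) = γ * (α * s) * q ^ (n + 2) by ring,
    show α * γ * s * q * q ^ (x + 1) = γ * (α * s) * q ^ (x + 2) by ring,
    show α * γ * s * q * q ^ (-(x : ℤ)) / (α * γ / (β * δ))
      = α * s * q * q ^ (-(x : ℤ)) / (α / (β * δ)) by field_simp,
    show q / (1 / γ) = γ * q by field_simp, show q / (1 / α) = α * q by field_simp,
    show q / (β / γ) = γ * q / β by field_simp,
    show α * γ / (β * δ) * q ^ (x + 1) = γ * (α / (β * δ)) * q ^ (x + 1) by ring,
    show α * s * β * q = β * (α * s) * q by ring]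
  rw [show α * γ * s * q = γ * (α * s) * q by ring] at vwp ⊢
  rw [show γ * (α * s) * q * q ^ (2 * k) = γ * (α * s) * q ^ (2 * k + 1) by ring] at vwp
  generalize qPoch q (q * (γ * (α * s) * q).sqrt) k = t1 at *
  generalize qPoch q (-(q * (γ * (α * s) * q).sqrt)) k = t2 at *
  generalize qPoch q (γ * (α * s) * q).sqrt k = t3 at *
  generalize qPoch q (-(γ * (α * s) * q).sqrt) k = t4 at *
  generalize qPoch q (γ * (α * s) * q) k = w1 at *
  generalize qPoch q (β * (α * s) * q) k = w2 at *
  generalize qPoch q q k = w3 at *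
  generalize qPoch q (γ * q / β) k = w4 at *
  generalize 1 - γ * (α * s) * q ^ (2 * k + 1) = d1 at *
  generalize 1 - γ * (α * s) * q = d2 at *
  rw [← hz]
  generalize qPoch q (q ^ (-(n : ℤ))) k = u1
  generalize qPoch q (q ^ (-(x : ℤ))) k = u2
  generalize qPoch q (γ * δ * q ^ (n + 1)) k = u3
  generalize qPoch q (γ * (α / (β * δ)) * q ^ (x + 1)) k = u4
  generalize qPoch q (γ * (α * s) * q ^ (n + 2)) k = u5
  generalize qPoch q (γ * (α * s) * q ^ (x + 2)) k = u6
  generalize qPoch q (α * s * q * q ^ (-(n : ℤ)) / δ) k = u7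
  generalize qPoch q (α * s * q * q ^ (-(x : ℤ)) / (α / (β * δ))) k = u8
  generalize qPoch q (α * q) k = u9
  generalize qPoch q (γ * q) k = u10
  generalize qPoch q (α * s * q) k = u11
  generalize qPoch q (γ * (α * s) * q / α) k = u12
  generalize (1 / (β * (α / (β * δ)))) ^ k = p1
  generalize (1 / (β * δ)) ^ k = p2
  generalize (α * β * q) ^ k = p3
  have cancel : w1 * w2 * d1 / (w3 * w4 * d2) * (w1 * w2 * d1 / (w3 * w4 * d2))
      / (w1 * w2 / (w3 * w4) * (d1 / d2)) = w1 * w2 / (w3 * w4) * (d1 / d2) := by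
    field_simp
  calc _ = w1 * w2 * d1 / (w3 * w4 * d2) * (w1 * w2 * d1 / (w3 * w4 * d2))
        / (w1 * w2 / (w3 * w4) * (d1 / d2)) * (u1 * u2 * u3 * u4 * u11 * u12 * p1 * p2 * p3
        / (u5 * u6 * u7 * u8 * u9 * u10)) := by
        simp only [div_eq_mul_inv, mul_inv, inv_inv]
        ring
    _ = _ := by
      rw [cancel, ← vwp]
      simp only [div_eq_mul_inv, mul_inv]
      ring

/-- The weight of the family with parameter `α/(βδ)`, after rescaling, is that of the family with
parameter `αs`. -/
theorem TrioGeneric.weight_div_trioScale (h : TrioGeneric q N α β γ δ s) {i : ℕ} (hi : i ≤ N) :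
    qRacahWeight q i α β γ (α / (β * δ)) / trioScale q β δ α s i
      = qRacahWeight q i α β γ (α * s) := by
  have hα := h.fst.α_ne
  have hβ := h.fst.β_ne
  have hδ := h.fst.δ_ne
  have n1 : qPoch q (β * δ * q) i ≠ 0 := qPoch_ne_zero fun j hj e =>
    h.fst.βδ_pow (j + 1) (by simp; omega) (by rw [← e]; ring)
  have n2 : qPoch q (α * q / δ) i ≠ 0 := qPoch_ne_zero fun j hj e =>
    h.fst.αδ_pow (j + 1) (by simp; omega) (by field_simp at e; rw [← e]; ring)
  have hz : (γ * (α * s) * q) ^ i = (γ * (α / (β * δ)) * q) ^ i * (β * δ * s) ^ i := by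
    rw [← mul_pow]; congr 1; field_simp
  simp only [trioScale, qRacahWeight, qPochs, List.map_cons, List.map_nil, List.prod_cons,
    List.prod_nil, mul_one, hz]
  rw [show β * (α / (β * δ)) * q = α * q / δ by field_simp,
    show α * q / (α / (β * δ)) = β * δ * q by field_simp,
    show β * (α * s) * q = α * β * s * q by ring,
    show α * q / (α * s) = q / s by field_simp, show q * α / δ = α * q / δ by ring]
  generalize qPoch q (β * δ * q) i = w1 at *
  generalize qPoch q (α * q / δ) i = w2 at *
  generalize (γ * (α / (β * δ)) * q) ^ i = p1
  generalize (β * δ * s) ^ i = p2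
  simp only [div_eq_mul_inv, mul_inv, inv_inv]
  rw [← sub_eq_zero]
  field_simp
  ring

/-- The two forms of the total mass are exchanged by the duality `(α, β) ↔ (γ, δ)`. -/
theorem qRacahMassFst_swap (N : ℕ) (α β γ δ : ℂ) :
    qRacahMassFst q N γ δ α β = qRacahMassThd q N α β γ δ := by
  simp only [qRacahMassFst, qRacahMassThd, qPochs, List.map_cons, List.map_nil, List.prod_cons,
    List.prod_nil]
  ring

/-- The coordinates with respect to `(ṽ_x)`, by orthogonality. -/
theorem TrioGeneric.coord_eq (h : TrioGeneric q N α β γ δ s)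
    (vt : Basis (Fin (N + 1)) ℂ (Fin (N + 1) → ℂ))
    (hvt : ∀ x, vt x = trioVecVt q N α β γ δ s x) (x : Fin (N + 1)) (F : ℕ → ℂ) :
    vt.coord x (fun i => F i) = qRacahMassFst q N γ (α / (β * δ)) α β
      * qRacahWeight q x γ (α / (β * δ)) α β * ∑ i ∈ Finset.range (N + 1),
        qRacahWeight q i α β γ (α * s) * qRacah q i x α β γ (α / (β * δ)) * F i := by
  have e : vt.coord x = (qRacahMassFst q N γ (α / (β * δ)) α β
      * qRacahWeight q x γ (α / (β * δ)) α β) • ∑ i : Fin (N + 1),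
        (qRacahWeight q i α β γ (α * s) * qRacah q i x α β γ (α / (β * δ)))
          • LinearMap.proj (R := ℂ) (φ := fun _ : Fin (N + 1) => ℂ) i := by
    refine vt.ext fun y => ?_
    have hs : ∑ i : Fin (N + 1), qRacahWeight q i α β γ (α * s)
        * qRacah q i x α β γ (α / (β * δ)) * trioVecVt q N α β γ δ s y i
        = ∑ i ∈ Finset.range (N + 1), qRacahWeight q i α β γ (α / (β * δ))
          * qRacah q i x α β γ (α / (β * δ)) * qRacah q i y α β γ (α / (β * δ)) := by
      rw [← Fin.sum_univ_eq_sum_range (fun i => qRacahWeight q i α β γ (α / (β * δ))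
          * qRacah q i x α β γ (α / (β * δ)) * qRacah q i y α β γ (α / (β * δ)))]
      refine Finset.sum_congr rfl fun i _ => ?_
      have hi : (i : ℕ) ≤ N := by omega
      have := h.trioScale_ne_zero hi
      rw [← h.weight_div_trioScale hi, show trioVecVt q N α β γ δ s y i
        = trioScale q β δ α s i * qRacah q i y α β γ (α / (β * δ)) from rfl]
      field_simp
    simp only [LinearMap.smul_apply, LinearMap.sum_apply, LinearMap.proj_apply, smul_eq_mul]
    rw [hvt y, hs, ← hvt y, Basis.coord_apply, Basis.repr_self]
    rcases eq_or_ne y x with rfl | hne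
    · rw [qRacahMassFst_swap, h.snd.norm h.cut (by omega), Finsupp.single_eq_same]
    · rw [h.snd.orthogonal (by omega) (by omega) (fun e => hne (Fin.ext e.symm)), mul_zero,
        Finsupp.single_eq_of_ne hne.symm]
  rw [e, ← Fin.sum_univ_eq_sum_range (fun i => qRacahWeight q i α β γ (α * s)
    * qRacah q i x α β γ (α / (β * δ)) * F i)]
  simp only [LinearMap.smul_apply, LinearMap.sum_apply, LinearMap.proj_apply, smul_eq_mul]

theorem RacahGeneric.connScale_ne_zero {ε : ℂ} (h : RacahGeneric q N α β γ δ)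
    (h' : RacahGeneric q N α β γ ε) (hδε : ∀ k < N, δ * q ^ k ≠ ε) {n : ℕ} (hn : n ≤ N) :
    connScale q β γ δ ε n ≠ 0 := by
  have hε := h'.δ_ne
  have hβ := h.β_ne
  have hq0 := h.q_ne
  simp only [connScale, qPochs, List.map_cons, List.map_nil, List.prod_cons, List.prod_nil,
    mul_one]
  refine div_ne_zero (mul_ne_zero (mul_ne_zero ?_ ?_) ?_) (mul_ne_zero ?_ ?_)
  · exact qPoch_ne_zero fun j hj e => hδε j (by omega) (by field_simp at e; rw [← e]; ring)
  · exact qPoch_ne_zero fun j hj e =>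
      h.γβ_pow (j + 1) (by simp; omega) (by field_simp at e; rw [← e]; ring)
  · exact pow_ne_zero _ (by simp [hβ, hε, hq0])
  · exact qPoch_ne_zero fun j hj e => h.βδ_pow (j + 1) (by simp; omega) (by rw [← e]; ring)
  · exact qPoch_ne_zero fun j hj e => h'.γδ_pow (j + 2) (by simp; omega) (by rw [← e]; ring)

/-- The total masses of the two weights that occur in the overlap coefficients differ by the
constant in front of the Wilson rational function. -/
theorem TrioGeneric.mass_eq (h : TrioGeneric q N α β γ δ s) :
    qRacahMassFst q N γ (α / (β * δ)) α β
      = qRacahMassThd q N α (1 / (q * α * s)) γ (α / (β * δ))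
        * qRacahMassFst q N γ (α * s) α β := by
  have hq0 := h.fst.q_ne
  have hα := h.fst.α_ne
  have hs := h.s_ne
  have n1 : qPoch q (1 / (α * s)) N ≠ 0 := qPoch_ne_zero fun j hj e => by
    -- `α s = q^j` is excluded since `γ α s q^{N+1-j} ≠ 1`
    refine h.mid.γδ_pow (N + 1 - j) (by simp; omega) ?_
    have e : q ^ j = α * s := by field_simp at e; exact e
    rw [← e, mul_assoc, ← pow_add, show j + (N + 1 - j) = N + 1 by omega, h.cut]
  have n2 : qPoch q (q / s) N ≠ 0 := qPoch_ne_zero fun j hj e =>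
    h.mid.αδ_pow (j + 1) (by simp; omega) (by
      field_simp at e; rw [← e]; ring)
  simp only [qRacahMassFst, qRacahMassThd, qPochs, List.map_cons, List.map_nil, List.prod_cons,
    List.prod_nil, mul_one]
  rw [show α * q / (α * s) = q / s by field_simp,
    show 1 / (q * α * s) * q = 1 / (α * s) by field_simp,
    show α * (1 / (q * α * s)) * q ^ 2 = q / s by field_simp]
  generalize qPoch q (1 / (α * s)) N = w1 at *
  generalize qPoch q (q / s) N = w2 at *
  simp only [div_eq_mul_inv, mul_inv, inv_inv]
  field_simp

/-- The weight with parameter `α/(βδ)` absorbs the normalisation of the connection coefficients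
and becomes a weight with other parameters. -/
theorem TrioGeneric.weight_mul_connScale (h : TrioGeneric q N α β γ δ s) {x : ℕ} (hx : x ≤ N) :
    qRacahWeight q x γ (α / (β * δ)) α β * connScale q β γ (α / (β * δ)) (α * s) x
      = qRacahWeight q x α (γ / (β * δ)) γ (1 / (s * q * γ)) := by
  have hq0 := h.fst.q_ne
  have hα := h.fst.α_ne
  have hγ := h.fst.γ_ne
  have hβ := h.fst.β_ne
  have hδ := h.fst.δ_ne
  have n1 : qPoch q (α * q / δ) x ≠ 0 := qPoch_ne_zero fun j hj e =>
    h.fst.αδ_pow (j + 1) (by simp; omega) (by field_simp at e; rw [← e]; ring)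
  have n2 : qPoch q (γ * q / β) x ≠ 0 := qPoch_ne_zero fun j hj e =>
    h.fst.γβ_pow (j + 1) (by simp; omega) (by field_simp at e; rw [← e]; ring)
  have hz : (β * (α * s) * q) ^ x * ((α * β * q) ^ x)⁻¹ = ((1 / s) ^ x)⁻¹ := by
    rw [← inv_pow, ← mul_pow, ← inv_pow]; congr 1; field_simp
  simp only [qRacahWeight, connScale, qPochs, List.map_cons, List.map_nil, List.prod_cons,
    List.prod_nil, mul_one]
  rw [show α / (β * δ) * β * q = α * q / δ by field_simp,
    show β * (α / (β * δ)) * q = α * q / δ by field_simp,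
    show α / (β * δ) / (α * s) = 1 / (β * δ * s) by field_simp,
    show γ / (β * δ) * (1 / (s * q * γ)) * q = 1 / (β * δ * s) by field_simp,
    show α * (γ / (β * δ)) * q / γ = α / (β * δ) * q by field_simp,
    show γ * (α / (β * δ)) * q / α = γ / (β * δ) * q by field_simp,
    show α * q / (1 / (s * q * γ)) = γ * (α * s) * q ^ 2 by field_simp,
    show γ * (1 / (s * q * γ)) * q = 1 / s by field_simp,
    show α * (γ / (β * δ)) * q = γ * (α / (β * δ)) * q by ring,
    show α * (γ / (β * δ)) * q ^ (2 * x + 1) = γ * (α / (β * δ)) * q ^ (2 * x + 1) by ring]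
  generalize qPoch q (α * q / δ) x = w1 at *
  generalize qPoch q (γ * q / β) x = w2 at *
  generalize qPoch q (1 / (β * δ * s)) x = w3
  generalize qPoch q (γ * (α / (β * δ)) * q) x = w4
  generalize qPoch q (α / (β * δ) * q) x = w5
  generalize qPoch q (γ / (β * δ) * q) x = w6
  generalize qPoch q (γ * (α * s) * q ^ 2) x = w7
  generalize 1 - γ * (α / (β * δ)) * q ^ (2 * x + 1) = d1
  generalize 1 - γ * (α / (β * δ)) * q = d2
  generalize (β * (α * s) * q) ^ x = p1 at *
  generalize (α * β * q) ^ x = p2 at *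
  generalize (1 / s) ^ x = p3 at *
  simp only [div_eq_mul_inv, mul_inv]
  rw [← hz]
  have k1 := mul_inv_cancel₀ n1
  have k2 := mul_inv_cancel₀ n2
  linear_combination (qPoch q (γ * q) x * qPoch q (α * q) x * w4 * (qPoch q q x)⁻¹ * w6⁻¹ * w5⁻¹
    * d1 * p2⁻¹ * d2⁻¹ * w3 * p1 * w7⁻¹) * (k1 * (w2 * w2⁻¹) + k2)

/-- The listed inequalities imply nondegeneracy of all three families. -/
theorem TrioGeneric.of_conditions {N : ℕ} {q α β γ δ s : ℂ}
    (hq0 : q ≠ 0) (hq : ∀ k : ℕ, 0 < k → q ^ k ≠ 1)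
    (hα : α ≠ 0) (hβ : β ≠ 0) (hδ : δ ≠ 0) (hs : s ≠ 0)
    (hγ : γ = q ^ (-(N : ℤ) - 1))
    (h1 : ∀ k ∈ Finset.Icc 1 N, α * q ^ k ≠ 1 ∧ β * q ^ k ≠ 1 ∧ β * δ * q ^ k ≠ 1 ∧
      α * q ^ k ≠ δ ∧ q ^ k ≠ s ∧ α * β * s * q ^ k ≠ 1)
    (h2 : ∀ k ∈ Finset.Icc 1 (2 * N + 1), α * β * q ^ k ≠ 1 ∧ γ * δ * q ^ k ≠ 1 ∧
      α * γ * q ^ k ≠ β * δ ∧ α * γ * s * q ^ k ≠ 1)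
    (h3 : ∀ k ∈ Finset.range N, δ * q ^ k ≠ α * s ∧ q ^ k ≠ β * δ * s) :
    TrioGeneric q N α β γ δ s := by
  have hcut : γ * q ^ (N + 1) = 1 := by
    rw [hγ, ← zpow_natCast, ← zpow_add₀ hq0]
    push_cast
    rw [show -(N : ℤ) - 1 + (N + 1) = 0 by ring, zpow_zero]
  refine ⟨hcut, hs, ?_, ?_, ?_, ?_, ?_⟩
  · exact .of_γ hq0 hq hα hβ hδ hcut (fun k hk => (h1 k hk).1) (fun k hk => (h1 k hk).2.1)
      (fun k hk => (h1 k hk).2.2.1) (fun k hk => (h1 k hk).2.2.2.1) (fun k hk => (h2 k hk).1)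
      (fun k hk => (h2 k hk).2.1)
  · refine .of_γ hq0 hq hα hβ (by simp [hα, hβ, hδ]) hcut (fun k hk => (h1 k hk).1)
      (fun k hk => (h1 k hk).2.1) (fun k hk e => (h1 k hk).2.2.2.1 ?_)
      (fun k hk e => (h1 k hk).2.2.1 ?_) (fun k hk => (h2 k hk).1)
      (fun k hk e => (h2 k hk).2.2.1 ?_)
    · field_simp at e; exact e
    · field_simp at e
      rw [← e]; ring
    · field_simp at e
      rw [← e]; ring
  · refine .of_γ hq0 hq hα hβ (by simp [hα, hs]) hcut (fun k hk => (h1 k hk).1)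
      (fun k hk => (h1 k hk).2.1) (fun k hk e => (h1 k hk).2.2.2.2.2 ?_)
      (fun k hk e => (h1 k hk).2.2.2.2.1 (mul_left_cancel₀ hα e)) (fun k hk => (h2 k hk).1)
      (fun k hk e => (h2 k hk).2.2.2 ?_)
    · rw [← e]; ring
    · rw [← e]; ring
  · exact fun k hk => (h3 k (Finset.mem_range.2 hk)).1
  · intro k hk e
    refine (h3 k (Finset.mem_range.2 hk)).2 ?_
    field_simp at e
    rw [e]

end Wilson

theorem mainTheorem1 (N : ℕ) (q α β γ δ s : ℂ)
    (hq0 : q ≠ 0) (hq : ∀ k : ℕ, 0 < k → q ^ k ≠ 1)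
    (hα : α ≠ 0) (hβ : β ≠ 0) (hδ : δ ≠ 0) (hs : s ≠ 0)
    (hγ : γ = q ^ (-(N : ℤ) - 1))
    -- genericity of the parameters
    (h1 : ∀ k ∈ Finset.Icc 1 N, α * q ^ k ≠ 1 ∧ β * q ^ k ≠ 1 ∧ β * δ * q ^ k ≠ 1 ∧
      α * q ^ k ≠ δ ∧ q ^ k ≠ s ∧ α * β * s * q ^ k ≠ 1)
    (h2 : ∀ k ∈ Finset.Icc 1 (2 * N + 1), α * β * q ^ k ≠ 1 ∧ γ * δ * q ^ k ≠ 1 ∧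
      α * γ * q ^ k ≠ β * δ ∧ α * γ * s * q ^ k ≠ 1)
    (h3 : ∀ k ∈ Finset.range N, δ * q ^ k ≠ α * s ∧ q ^ k ≠ β * δ * s) :
    -- the eigenvectors form bases, and `(V, Ṽ, Z)` is an irreducible Leonard trio
    ∃ v vt : Basis (Fin (N + 1)) ℂ (Fin (N + 1) → ℂ),
      (∀ n, v n = trioVecV q N α β γ δ n) ∧
      (∀ x, vt x = trioVecVt q N α β γ δ s x) ∧
      IsIrredLeonardTrio (trioV q N α β γ δ) (trioVt q N α β γ δ s) (trioZ q N α β s)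
        v vt (Pi.basisFun ℂ (Fin (N + 1))) ∧
      (∀ n, trioV q N α β γ δ (v n) = qRacahEig q n (γ * δ) • v n) ∧
      (∀ x, trioVt q N α β γ δ s (vt x) = qRacahEig q x (α * γ / (β * δ)) • vt x) ∧
      ∀ n x : Fin (N + 1),
        -- the overlap coefficient `w_n(x)` as a sum of products of `q`-Racah polynomials
        vt.coord x (v n) =
          qRacahMassFst q N γ (α / (β * δ)) α β * qRacahWeight q x γ (α / (β * δ)) α β
            * ∑ i ∈ Finset.range (N + 1), qRacahWeight q i α β γ (α * s)
                * qRacah q i x α β γ (α / (β * δ)) * qRacah q i n α β γ δ ∧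
        -- the overlap coefficient `w_n(x)` as a Wilson rational function
        vt.coord x (v n) =
          qRacahMassThd q N α (1 / (q * α * s)) γ (α / (β * δ))
            * qRacahWeight q x α (γ / (β * δ)) γ (1 / (s * q * γ))
            * (qPochs q [δ / (α * s), γ * q / β] n * (α * β * s * q) ^ (n : ℕ)
                / qPochs q [β * δ * q, α * γ * s * q ^ 2] n)
            * wilsonRat q n x (α * γ * s * q) (γ * δ) (α * γ / (β * δ))
                (1 / γ) (1 / α) (β / γ) ∧
        -- the summation formula for the Wilson rational function
        wilsonRat q n x (α * γ * s * q) (γ * δ) (α * γ / (β * δ)) (1 / γ) (1 / α) (β / γ) =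
          qPochs q [α * q / δ, α * γ * s * q ^ 2] x
              / (qPochs q [1 / (β * δ * s), γ * q / β] x * (α * β * s * q) ^ (x : ℕ))
            * (qPochs q [β * δ * q, α * γ * s * q ^ 2] n
              / (qPochs q [δ / (α * s), γ * q / β] n * (α * β * s * q) ^ (n : ℕ)))
            * (qRacahMassFst q N γ (α * s) α β
              * ∑ i ∈ Finset.range (N + 1), qRacahWeight q i α β γ (α * s)
                  * qRacah q i x α β γ (α / (β * δ)) * qRacah q i n α β γ δ) := by
  have h : TrioGeneric q N α β γ δ s := .of_conditions hq0 hq hα hβ hδ hs hγ h1 h2 h3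
  obtain ⟨v, hv⟩ := h.fst.exists_basis (trioV q N α β γ δ) (trioVecV q N α β γ δ)
    (fun n hn => h.fst.trioV_apply hn) (fun n => by simp [trioVecV, qRacah_zero_left])
  obtain ⟨vt, hvt⟩ := h.snd.exists_basis (trioVt q N α β γ δ s) (trioVecVt q N α β γ δ s)
    (fun x hx => h.trioVt_apply hx)
    (fun x => by simp [trioVecVt, qRacah_zero_left, qPochs])
  refine ⟨v, vt, hv, hvt, h.isIrredLeonardTrio v vt hv hvt, fun n => ?_, fun x => ?_,
    fun n x => ?_⟩
  · rw [hv]; exact h.fst.trioV_apply (by omega)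
  · rw [hvt, show α * γ / (β * δ) = γ * (α / (β * δ)) by ring]
    exact h.trioVt_apply (by omega)
  have hn : (n : ℕ) ≤ N := by omega
  have hx : (x : ℕ) ≤ N := by omega
  have c1 := h.coord_eq vt hvt x (fun i => qRacah q i n α β γ δ)
  rw [show (fun i : Fin (N + 1) => qRacah q i n α β γ δ) = v n from (hv n).symm] at c1
  have c2 := mass_mul_sum_weight_qRacah h.fst h.snd h.mid h.δ_pow_ne h.δ'_pow_ne h.cut hn hx
  rw [h.sum_connCoeff_eq_wilsonRat hn, ← qRacahMassFst_swap] at c2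
  have pn := h.fst.connScale_ne_zero h.mid h.δ_pow_ne hn
  have px := h.snd.connScale_ne_zero h.mid h.δ'_pow_ne hx
  have en : connScale q β γ δ (α * s) n = qPochs q [δ / (α * s), γ * q / β] n
      * (α * β * s * q) ^ (n : ℕ) / qPochs q [β * δ * q, α * γ * s * q ^ 2] n := by
    rw [connScale, show β * (α * s) * q = α * β * s * q by ring,
      show γ * (α * s) * q ^ 2 = α * γ * s * q ^ 2 by ring]
  have ex : connScale q β γ (α / (β * δ)) (α * s) x = qPochs q [1 / (β * δ * s), γ * q / β] x
      * (α * β * s * q) ^ (x : ℕ) / qPochs q [α * q / δ, α * γ * s * q ^ 2] x := by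
    rw [connScale, show β * (α * s) * q = α * β * s * q by ring,
      show γ * (α * s) * q ^ 2 = α * γ * s * q ^ 2 by ring,
      show α / (β * δ) / (α * s) = 1 / (β * δ * s) by field_simp,
      show β * (α / (β * δ)) * q = α * q / δ by field_simp]
  refine ⟨c1, ?_, ?_⟩
  · rw [c1, ← en, ← h.weight_mul_connScale hx, h.mass_eq]
    linear_combination (qRacahMassThd q N α (1 / (q * α * s)) γ (α / (β * δ))
      * qRacahWeight q x γ (α / (β * δ)) α β) * c2
  · rw [← inv_div (qPochs q [1 / (β * δ * s), γ * q / β] x * _), ← ex,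
      ← inv_div (qPochs q [δ / (α * s), γ * q / β] n * _), ← en, c2]
    clear en ex c1 c2
    generalize connScale q β γ (α / (β * δ)) (α * s) x = p₁ at px ⊢
    generalize connScale q β γ δ (α * s) n = p₂ at pn ⊢
    generalize wilsonRat q n x (α * γ * s * q) _ _ _ _ _ = W
    field_simp
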